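/- All vector spaces are over $\mathbb{K}=\mathbb{R}$ or $\mathbb{C}$. Let $(X,\|\cdot\|_X)$ be a quasi-Banach space and let $Y\subseteq X$ be a linear subspace with $Y\neq X$ that is itself a quasi-Banach space under a quasi-norm $\|\cdot\|_Y$ and is continuously embedded into $X$, i.e. $\|y\|_X\le M\|y\|_Y$ for all $y\in Y$ and some constant $M$. For $x\in X$ and $t>0$ let $$K(x,t,X,Y)=\inf_{y\in Y}\bigl(\|x-y\|_X+t\|y\|_Y\bigr),$$ and for $0<\theta<1$, $0<q\le\infty$ (with $1/\infty=0$) let $$(X,Y)_{\theta,q}=\Bigl\{x\in X:\ \bigl\|t^{-(\theta+1/q)}K(x,t,X,Y)\bigr\|_{L^q(0,\infty)}<\infty\Bigr\},$$ which is a linear subspace of $X$. Then: (a) If $Y$ is not closed in $X$, then $(X,Y)_{\theta_0,p}\neq (X,Y)_{\theta_1,q}$ for all $\theta_0,\theta_1\in(0,1)$ with $\theta_0\neq\theta_1$ and all $0<p,q\le\infty$. (b) If $0<\theta<1$ and $0<p,q\le\infty$ are such that $(X,Y)_{\theta,p}\neq(X,Y)_{\theta,q}$, then $(X,Y)_{\theta,r_1}\neq(X,Y)_{\theta,r_2}$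 for all $r_1\neq r_2$ in the closed interval with endpoints $p$ and $q$. (c) If $Y$ is not closed in $X$, then for all $0<\theta<1$ and $0<p\le\infty$ the space $(X,Y)_{\theta,p}$ has infinite codimension in $X$, and $Y$ is contained in $(X,Y)_{\theta,p}$ and has infinite codimension in it. -/

import Mathlib

open MeasureTheory Filter Topology
open scoped ENNReal

/-- A quasi-norm on a vector space `E` over `𝕜 = ℝ` or `ℂ`: a norm, except that the triangle
inequality is only required up to a multiplicative constant. -/
structure QuasiNorm (𝕜 : Type*) [RCLike 𝕜] (E : Type*) [AddCommGroup E] [Module 𝕜 E] where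
  /-- The underlying function. -/
  toFun : E → ℝ
  nonneg' : ∀ x, 0 ≤ toFun x
  eq_zero_iff' : ∀ x, toFun x = 0 ↔ x = 0
  smul' : ∀ (c : 𝕜) (x : E), toFun (c • x) = ‖c‖ * toFun x
  exists_add_le' : ∃ C : ℝ, ∀ x y, toFun (x + y) ≤ C * (toFun x + toFun y)

namespace QuasiNorm

variable {𝕜 : Type*} [RCLike 𝕜] {E : Type*} [AddCommGroup E] [Module 𝕜 E]

instance : CoeFun (QuasiNorm 𝕜 E) (fun _ => E → ℝ) := ⟨QuasiNorm.toFun⟩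

/-- `(E, N)` is a quasi-Banach space: every `N`-Cauchy sequence `N`-converges. -/
def IsQuasiBanach (N : QuasiNorm 𝕜 E) : Prop :=
  ∀ u : ℕ → E,
    (∀ ε : ℝ, 0 < ε → ∃ n₀ : ℕ, ∀ m n : ℕ, n₀ ≤ m → n₀ ≤ n → N (u m - u n) < ε) →
    ∃ x : E, Tendsto (fun n => N (u n - x)) atTop (𝓝 0)

/-- The set `S` is closed in `(E, N)`: it contains the limits of all its `N`-convergent
sequences. (The topology of a quasi-norm is metrizable, so this is closedness.) -/
def IsClosedSet (N : QuasiNorm 𝕜 E) (S : Set E) : Prop :=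
  ∀ (u : ℕ → E) (x : E), (∀ n, u n ∈ S) → Tendsto (fun n => N (u n - x)) atTop (𝓝 0) → x ∈ S

/-- The inclusion of the quasi-normed space `(Y, NY)`, `Y` a linear subspace of `X`, into
`(X, NX)` is continuous, that is, bounded. -/
def ContinuouslyEmbedded (NX : QuasiNorm 𝕜 E) {Y : Submodule 𝕜 E} (NY : QuasiNorm 𝕜 Y) : Prop :=
  ∃ M : ℝ, ∀ y : Y, NX (y : E) ≤ M * NY y

/-- Peetre's `K`-functional `K(x, t, X, Y) = inf_{y ∈ Y} (‖x - y‖_X + t ‖y‖_Y)`, for `t > 0`. -/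
noncomputable def peetreK (NX : QuasiNorm 𝕜 E) {Y : Submodule 𝕜 E} (NY : QuasiNorm 𝕜 Y)
    (x : E) (t : ℝ) : ℝ :=
  ⨅ y : Y, (NX (x - (y : E)) + t * NY y)

/-- `ρ_{θ,q}(x) = ‖t ^ (-(θ + 1/q)) K(x, t, X, Y)‖_{L^q(0,∞)}`, with values in `[0, ∞]`
(`1/∞ = 0`, and `L^∞` is the essential supremum). -/
noncomputable def interpFunctional (NX : QuasiNorm 𝕜 E) {Y : Submodule 𝕜 E} (NY : QuasiNorm 𝕜 Y)
    (θ : ℝ) (q : ℝ≥0∞) (x : E) : ℝ≥0∞ :=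
  eLpNorm (fun t : ℝ => t ^ (-(θ + (q⁻¹).toReal)) * peetreK NX NY x t) q
    (volume.restrict (Set.Ioi (0 : ℝ)))

theorem peetreK_bdd (NX : QuasiNorm 𝕜 E) {Y : Submodule 𝕜 E} (NY : QuasiNorm 𝕜 Y)
    (x : E) {t : ℝ} (ht : 0 ≤ t) :
    BddBelow (Set.range fun y : Y => NX (x - (y : E)) + t * NY y) :=
  ⟨0, by
    rintro _ ⟨y, rfl⟩
    exact add_nonneg (NX.nonneg' _) (mul_nonneg ht (NY.nonneg' _))⟩

theorem peetreK_nonneg (NX : QuasiNorm 𝕜 E) {Y : Submodule 𝕜 E} (NY : QuasiNorm 𝕜 Y)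
    (x : E) {t : ℝ} (ht : 0 ≤ t) : 0 ≤ peetreK NX NY x t :=
  le_ciInf fun _ => add_nonneg (NX.nonneg' _) (mul_nonneg ht (NY.nonneg' _))

theorem peetreK_zero (NX : QuasiNorm 𝕜 E) {Y : Submodule 𝕜 E} (NY : QuasiNorm 𝕜 Y)
    {t : ℝ} (ht : 0 ≤ t) : peetreK NX NY 0 t = 0 := by
  refine le_antisymm ?_ (peetreK_nonneg NX NY 0 ht)
  refine (ciInf_le (peetreK_bdd NX NY 0 ht) 0).trans ?_
  have h1 : NX.toFun 0 = 0 := (NX.eq_zero_iff' 0).2 rfl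
  have h2 : NY.toFun 0 = 0 := (NY.eq_zero_iff' 0).2 rfl
  simp [h1, h2]

theorem peetreK_smul_le (NX : QuasiNorm 𝕜 E) {Y : Submodule 𝕜 E} (NY : QuasiNorm 𝕜 Y)
    (c : 𝕜) (x : E) {t : ℝ} (ht : 0 ≤ t) :
    peetreK NX NY (c • x) t ≤ ‖c‖ * peetreK NX NY x t := by
  unfold peetreK
  rw [Real.mul_iInf_of_nonneg (norm_nonneg c)]
  refine le_ciInf fun y => (ciInf_le (peetreK_bdd NX NY (c • x) ht) (c • y)).trans_eq ?_
  rw [Submodule.coe_smul, ← smul_sub, NX.smul', NY.smul']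
  ring

theorem exists_peetreK_add_le (NX : QuasiNorm 𝕜 E) {Y : Submodule 𝕜 E} (NY : QuasiNorm 𝕜 Y) :
    ∃ C : ℝ, 0 < C ∧ ∀ (x x' : E) (t : ℝ), 0 ≤ t →
      peetreK NX NY (x + x') t ≤ C * (peetreK NX NY x t + peetreK NX NY x' t) := by
  obtain ⟨A, hA⟩ := NX.exists_add_le'
  obtain ⟨B, hB⟩ := NY.exists_add_le'
  have hC : 0 < max 1 (max A B) := lt_max_of_lt_left one_pos
  refine ⟨max 1 (max A B), hC, fun x x' t ht => ?_⟩
  set C := max 1 (max A B)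
  have hAC : A ≤ C := (le_max_left _ _).trans (le_max_right _ _)
  have hBC : B ≤ C := (le_max_right _ _).trans (le_max_right _ _)
  rw [← div_le_iff₀' hC]
  unfold peetreK
  refine le_ciInf_add_ciInf fun y y' => ?_
  rw [div_le_iff₀' hC]
  refine (ciInf_le (peetreK_bdd NX NY (x + x') ht) (y + y')).trans ?_
  have e : x + x' - ((y + y' : Y) : E) = (x - y) + (x' - y') := by
    rw [Submodule.coe_add]; abel
  rw [e]
  have h1 := (hA (x - y) (x' - y')).trans
    (mul_le_mul_of_nonneg_right hAC (add_nonneg (NX.nonneg' _) (NX.nonneg' _)))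
  have h2 := mul_le_mul_of_nonneg_left ((hB y y').trans
    (mul_le_mul_of_nonneg_right hBC (add_nonneg (NY.nonneg' _) (NY.nonneg' _)))) ht
  linarith

theorem peetreK_aestronglyMeasurable (NX : QuasiNorm 𝕜 E) {Y : Submodule 𝕜 E}
    (NY : QuasiNorm 𝕜 Y) (s : ℝ) (x : E) :
    AEStronglyMeasurable (fun t : ℝ => t ^ s * peetreK NX NY x t)
      (volume.restrict (Set.Ioi (0 : ℝ))) := by
  have hK : AEMeasurable (peetreK NX NY x) (volume.restrict (Set.Ioi (0 : ℝ))) := by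
    refine aemeasurable_restrict_of_monotoneOn measurableSet_Ioi fun t ht t' _ htt => ?_
    exact ciInf_mono (peetreK_bdd NX NY x (le_of_lt ht)) fun y =>
      add_le_add_right (mul_le_mul_of_nonneg_right htt (NY.nonneg' y)) _
  exact ((measurable_id.pow_const s).aemeasurable.mul hK).aestronglyMeasurable

/-- The real interpolation space `(X, Y)_{θ,q} = {x ∈ X : ρ_{θ,q}(x) < ∞}`, as a linear subspace
of `X`. -/
noncomputable def interp (NX : QuasiNorm 𝕜 E) {Y : Submodule 𝕜 E} (NY : QuasiNorm 𝕜 Y)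
    (θ : ℝ) (q : ℝ≥0∞) : Submodule 𝕜 E where
  carrier := {x | interpFunctional NX NY θ q x < ∞}
  zero_mem' := by
    have h : (fun t : ℝ => t ^ (-(θ + (q⁻¹).toReal)) * peetreK NX NY 0 t)
        =ᵐ[volume.restrict (Set.Ioi (0 : ℝ))] 0 := by
      filter_upwards [ae_restrict_mem measurableSet_Ioi] with t ht
      simp [peetreK_zero NX NY (le_of_lt ht)]
    change eLpNorm _ q _ < ∞
    rw [eLpNorm_congr_ae h, eLpNorm_zero]
    exact ENNReal.zero_lt_top
  add_mem' := by
    intro x x' hx hx'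
    obtain ⟨C, hC, h⟩ := exists_peetreK_add_le NX NY
    have hm : MemLp _ q (volume.restrict (Set.Ioi (0 : ℝ))) :=
      ⟨peetreK_aestronglyMeasurable NX NY (-(θ + (q⁻¹).toReal)) x, hx⟩
    have hm' : MemLp _ q (volume.restrict (Set.Ioi (0 : ℝ))) :=
      ⟨peetreK_aestronglyMeasurable NX NY (-(θ + (q⁻¹).toReal)) x', hx'⟩
    refine (eLpNorm_mono_ae ?_).trans_lt ((hm.add hm').const_mul C).2
    filter_upwards [ae_restrict_mem measurableSet_Ioi] with t ht
    have ht0 : (0 : ℝ) ≤ t := le_of_lt ht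
    have hp := Real.rpow_nonneg ht0 (-(θ + (q⁻¹).toReal))
    rw [Real.norm_of_nonneg (mul_nonneg hp (peetreK_nonneg NX NY _ ht0))]
    refine le_trans ?_ (le_abs_self _)
    refine (mul_le_mul_of_nonneg_left (h x x' t ht0) hp).trans_eq ?_
    simp only [Pi.add_apply]
    ring
  smul_mem' := by
    intro c x hx
    have hm : MemLp _ q (volume.restrict (Set.Ioi (0 : ℝ))) :=
      ⟨peetreK_aestronglyMeasurable NX NY (-(θ + (q⁻¹).toReal)) x, hx⟩
    refine (eLpNorm_mono_ae ?_).trans_lt (hm.const_mul ‖c‖).2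
    filter_upwards [ae_restrict_mem measurableSet_Ioi] with t ht
    have ht0 : (0 : ℝ) ≤ t := le_of_lt ht
    have hp := Real.rpow_nonneg ht0 (-(θ + (q⁻¹).toReal))
    rw [Real.norm_of_nonneg (mul_nonneg hp (peetreK_nonneg NX NY _ ht0))]
    refine le_trans ?_ (le_abs_self _)
    refine (mul_le_mul_of_nonneg_left (peetreK_smul_le NX NY c x ht0) hp).trans_eq ?_
    ring

end QuasiNorm

/-- The linear subspace `A` has infinite codimension in the linear subspace `B` of `E`:
`A ⊆ B` and the quotient `B / A` is infinite-dimensional. -/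
def HasInfiniteCodimIn {𝕜 E : Type*} [Field 𝕜] [AddCommGroup E] [Module 𝕜 E]
    (A B : Submodule 𝕜 E) : Prop :=
  A ≤ B ∧ ¬ FiniteDimensional 𝕜 (B ⧸ A.submoduleOf B)

/-! If `Y` is closed, every interpolation space is `Y`: membership forces `K(x, t) → 0` as `t → 0`,
which puts `x` in the closure of `Y`. So the hypothesis of (b) already excludes closedness, and all
three parts concern a non-closed `Y`.

The key fact for such `Y` is `exists_le_peetreK_of_not_isClosedSet`: there are a fixed `c > 0`,
arbitrarily small `t` and `u ∈ Y` with `‖u‖_X ≤ 1`, `t‖u‖_Y ≤ 1` and `K(u, t) ≥ c`. Suppose instead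
that `K` is small for all admissible `u` at all small scales. Splitting `u` almost optimally,
rescaling both pieces to neighbouring scales and iterating gives `K(u, s) ≲ s √(‖u‖_X ‖u‖_Y)`. This
improves itself to `K(u, s) ≤ D s ‖u‖_X`. At one small `s` the `K`-functional is then a small
multiple of `‖u‖_X`, and successive approximation, as in the open mapping theorem, shows that `Y` is
closed.

Given good elements `u_n` at rapidly decreasing scales `t_n`, put `x = ∑ a_n t_n^θ u_n`. By
Aoki–Rolewicz a small power of `K` is subadditive up to a factor `2`, so the terms barely interact:
`K(x, t_n)` is at least a multiple of `a_n t_n^θ`, and `K(x, s)` is bounded by a kernel sum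
concentrated at `t_n ≈ s` (`exists_peetreK_lacunary`). Constant `a` separates different `θ`; `a_n =
(n+1)^(-1/p)` separates `p` from every `q > p`. Part (c) follows from infinite strict chains in `θ`.
-/

/-! ### Aoki–Rolewicz: powers of quasi-norms. -/

/-- The quasi-triangle inequality with constant `C`. -/
def QuasiAdd {E : Type*} [Add E] (C : ℝ) (f : E → ℝ) : Prop :=
  ∀ x y, f (x + y) ≤ C * (f x + f y)

theorem QuasiAdd.mono {E : Type*} [Add E] {C C' : ℝ} {f : E → ℝ} (h : QuasiAdd C f)
    (hC : C ≤ C') (hf : ∀ x, 0 ≤ f x) : QuasiAdd C' f := fun x y =>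
  (h x y).trans (mul_le_mul_of_nonneg_right hC (add_nonneg (hf x) (hf y)))

/-- The Aoki–Rolewicz theorem: a sufficiently small power of a quasi-subadditive even function is
finitely subadditive up to a factor `2`. -/
theorem QuasiAdd.exists_rpow_sum_le {C : ℝ} (hC : 1 ≤ C) :
    ∃ ρ₀ : ℝ, 0 < ρ₀ ∧ ∀ ρ : ℝ, 0 < ρ → ρ ≤ ρ₀ →
      ∀ {E : Type*} [AddCommGroup E] (f : E → ℝ), (∀ x, 0 ≤ f x) → f 0 = 0 →
        (∀ x, f (-x) = f x) → QuasiAdd C f →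
        ∀ {ι : Type} (s : Finset ι) (x : ι → E),
          f (∑ i ∈ s, x i) ^ ρ ≤ 2 * ∑ i ∈ s, f (x i) ^ ρ := by
  have hB : 1 < 3 * C ^ 2 := by nlinarith
  have hlog : 0 < Real.log (3 * C ^ 2) := Real.log_pos hB
  -- This exponent solves `(3 * C ^ 2) ^ ρ₀ = 2`; `3 * C ^ 2` is the loss when a difference is split
  -- into three.
  refine ⟨Real.log 2 / Real.log (3 * C ^ 2), div_pos (Real.log_pos one_lt_two) hlog, ?_⟩
  intro ρ hρ hρ₀ E _ f hf0 hfz hfn hf ι s x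
  have hBρ : (3 * C ^ 2) ^ ρ ≤ 2 := by
    rw [Real.rpow_def_of_pos (by positivity), ← Real.le_log_iff_exp_le two_pos, mul_comm]
    exact (le_div_iff₀ hlog).1 hρ₀
  let d : E → E → NNReal := fun a b => (f (a - b) ^ ρ).toNNReal
  have hdf : ∀ a b, (d a b : ℝ) = f (a - b) ^ ρ := fun a b =>
    Real.coe_toNNReal _ (Real.rpow_nonneg (hf0 _) _)
  have hself : ∀ a, d a a = 0 := fun a => by
    apply NNReal.eq
    simp [hdf, hfz, Real.zero_rpow hρ.ne']
  have hcomm : ∀ a b, d a b = d b a := fun a b => by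
    apply NNReal.eq
    rw [hdf, hdf, ← hfn, neg_sub]
  have hd : ∀ a b c e, d a e ≤ 2 * max (d a b) (max (d b c) (d c e)) := by
    intro a b c e
    rw [← NNReal.coe_le_coe]
    push_cast
    simp only [hdf]
    set m := max (f (a - b)) (max (f (b - c)) (f (c - e))) with hm
    have hm1 : f (a - b) ≤ m := le_max_left _ _
    have hm2 : f (b - c) ≤ m := (le_max_left _ _).trans (le_max_right _ _)
    have hm3 : f (c - e) ≤ m := (le_max_right _ _).trans (le_max_right _ _)
    have hm0 : 0 ≤ m := (hf0 _).trans hm1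
    have h1 : f (a - e) ≤ 3 * C ^ 2 * m := by
      have e1 : a - e = (a - b) + ((b - c) + (c - e)) := by abel
      rw [e1]
      have := hf (a - b) ((b - c) + (c - e))
      have h2 := hf (b - c) (c - e)
      have h3 : f (b - c + (c - e)) ≤ C * (2 * m) :=
        h2.trans (mul_le_mul_of_nonneg_left (by linarith) (by linarith))
      have h4 : C * (f (a - b) + f (b - c + (c - e))) ≤ C * (m + C * (2 * m)) :=
        mul_le_mul_of_nonneg_left (by linarith) (by linarith)
      have h5 : C * m ≤ C ^ 2 * m := mul_le_mul_of_nonneg_right (by nlinarith) hm0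
      nlinarith
    have hmax : m ^ ρ = max (f (a - b) ^ ρ) (max (f (b - c) ^ ρ) (f (c - e) ^ ρ)) := by
      have mono : MonotoneOn (fun y : ℝ => y ^ ρ) (Set.Ici 0) :=
        fun y hy z hz hyz => Real.rpow_le_rpow hy hyz hρ.le
      have k1 := mono.map_max (a := f (b - c)) (b := f (c - e)) (hf0 _) (hf0 _)
      have k2 := mono.map_max (a := f (a - b)) (b := max (f (b - c)) (f (c - e))) (hf0 _)
        (le_max_of_le_left (hf0 (b - c)))
      rw [hm, k2, k1]
    rw [← hmax]
    calc f (a - e) ^ ρ ≤ (3 * C ^ 2 * m) ^ ρ := Real.rpow_le_rpow (hf0 _) h1 hρ.le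
      _ = (3 * C ^ 2) ^ ρ * m ^ ρ := Real.mul_rpow (by positivity) hm0
      _ ≤ 2 * m ^ ρ := mul_le_mul_of_nonneg_right hBρ (Real.rpow_nonneg hm0 _)
  -- Frink's chain construction: the four-point inequality with factor `2` yields a genuine
  -- pseudometric within a factor `2` of `d`.
  let _ := PseudoMetricSpace.ofPreNNDist d hself hcomm
  have hle : ∀ a b : E, dist a b ≤ f (a - b) ^ ρ :=
    fun a b => hdf a b ▸ PseudoMetricSpace.dist_ofPreNNDist_le d hself hcomm a b
  have hge : ∀ a b : E, f (a - b) ^ ρ ≤ 2 * dist a b :=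
    fun a b => hdf a b ▸ PseudoMetricSpace.le_two_mul_dist_ofPreNNDist d hself hcomm hd a b
  have key : dist (∑ i ∈ s, x i) 0 ≤ ∑ i ∈ s, f (x i) ^ ρ := by
    classical
    induction s using Finset.induction_on with
    | empty => simp
    | insert a s has ih =>
      rw [Finset.sum_insert has, Finset.sum_insert has]
      have h1 := dist_triangle (x a + ∑ i ∈ s, x i) (∑ i ∈ s, x i) 0
      have h2 := hle (x a + ∑ i ∈ s, x i) (∑ i ∈ s, x i)
      rw [add_sub_cancel_right] at h2
      linarith
  have := hge (∑ i ∈ s, x i) 0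
  rw [sub_zero] at this
  linarith

/-! ### Elementary properties of quasi-norms and of the `K`-functional. -/

namespace QuasiNorm

variable {𝕜 : Type*} [RCLike 𝕜] {E : Type*} [AddCommGroup E] [Module 𝕜 E]

theorem map_zero' (N : QuasiNorm 𝕜 E) : N 0 = 0 := (N.eq_zero_iff' 0).2 rfl

theorem map_neg' (N : QuasiNorm 𝕜 E) (x : E) : N (-x) = N x := by
  have := N.smul' (-1) x
  simpa using this

theorem map_real_smul (N : QuasiNorm 𝕜 E) {r : ℝ} (hr : 0 ≤ r) (x : E) :
    N ((r : 𝕜) • x) = r * N x := by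
  rw [N.smul', RCLike.norm_ofReal, abs_of_nonneg hr]

/-- A series with geometrically decaying terms has a sum. -/
theorem IsQuasiBanach.exists_tendsto_sum {N : QuasiNorm 𝕜 E} (hN : N.IsQuasiBanach) {C : ℝ}
    (hC : 1 ≤ C) (hadd : QuasiAdd C N) {w : ℕ → E} {L μ : ℝ} (hL : 0 ≤ L) (hμ0 : 0 ≤ μ)
    (hμ : 2 * C * μ ≤ 1) (hw : ∀ n, N (w n) ≤ L * μ ^ n) :
    ∃ x : E, Tendsto (fun n => N (∑ i ∈ Finset.range n, w i - x)) atTop (𝓝 0) := by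
  -- The bound is uniform in `k`: the factor `C` lost on peeling off a term is absorbed by the
  -- ratio, as `2 * C * μ ≤ 1`.
  have key : ∀ k n, N (∑ i ∈ Finset.range (n + k), w i - ∑ i ∈ Finset.range n, w i)
      ≤ 2 * C * L * μ ^ n := by
    intro k
    induction k with
    | zero =>
      intro n
      rw [add_zero, sub_self, N.map_zero']
      positivity
    | succ k ih =>
      intro n
      have e : ∑ i ∈ Finset.range (n + (k + 1)), w i - ∑ i ∈ Finset.range n, w i
          = w n + (∑ i ∈ Finset.range (n + 1 + k), w i - ∑ i ∈ Finset.range (n + 1), w i) := by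
        rw [Finset.sum_range_succ _ n, show n + (k + 1) = n + 1 + k by ring]; abel
      rw [e]
      have h1 := hadd (w n) (∑ i ∈ Finset.range (n + 1 + k), w i - ∑ i ∈ Finset.range (n + 1), w i)
      have h2 := hw n
      have h3 := ih (n + 1)
      have h4 : 2 * C * L * μ ^ (n + 1) ≤ L * μ ^ n := by
        have : 0 ≤ L * μ ^ n := by positivity
        rw [pow_succ]; nlinarith
      have h5 : C * (N (w n) + N (∑ i ∈ Finset.range (n + 1 + k), w i
          - ∑ i ∈ Finset.range (n + 1), w i)) ≤ C * (L * μ ^ n + L * μ ^ n) :=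
        mul_le_mul_of_nonneg_left (by linarith) (by linarith)
      linarith
  apply hN
  intro ε hε
  have hμ1 : μ < 1 := by nlinarith
  have ht : Tendsto (fun n => 2 * C * L * μ ^ n) atTop (𝓝 0) := by
    simpa using (tendsto_pow_atTop_nhds_zero_of_lt_one hμ0 hμ1).const_mul (2 * C * L)
  obtain ⟨n₀, hn₀⟩ := eventually_atTop.1 (ht.eventually (gt_mem_nhds hε))
  refine ⟨n₀, fun m n hm hn => ?_⟩
  rcases le_total n m with h | h
  · obtain ⟨k, rfl⟩ := Nat.exists_eq_add_of_le h
    exact (key k n).trans_lt (hn₀ n hn)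
  · obtain ⟨k, rfl⟩ := Nat.exists_eq_add_of_le h
    rw [← N.map_neg', neg_sub]
    exact (key k m).trans_lt (hn₀ m hm)

theorem tendsto_unique' {N : QuasiNorm 𝕜 E} {u : ℕ → E} {x y : E}
    (hx : Tendsto (fun n => N (u n - x)) atTop (𝓝 0))
    (hy : Tendsto (fun n => N (u n - y)) atTop (𝓝 0)) : x = y := by
  obtain ⟨C, hC⟩ := N.exists_add_le'
  have h : Tendsto (fun n => C * (N (u n - x) + N (u n - y))) atTop (𝓝 0) := by
    simpa using (hx.add hy).const_mul C
  have h2 : ∀ n, N (y - x) ≤ C * (N (u n - x) + N (u n - y)) := fun n => by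
    have := hC (u n - x) (-(u n - y))
    rw [N.map_neg'] at this
    rwa [show u n - x + -(u n - y) = y - x by abel] at this
  have h3 : N (y - x) ≤ 0 := ge_of_tendsto' h h2
  exact (sub_eq_zero.1 ((N.eq_zero_iff' _).1 (le_antisymm h3 (N.nonneg' _)))).symm

section Peetre

variable (NX : QuasiNorm 𝕜 E) {Y : Submodule 𝕜 E} (NY : QuasiNorm 𝕜 Y)

theorem exists_quasiAdd : ∃ C : ℝ, 1 ≤ C ∧ QuasiAdd C NX ∧ QuasiAdd C NY ∧
    ∀ t : ℝ, 0 ≤ t → QuasiAdd C (fun x => peetreK NX NY x t) := by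
  obtain ⟨A, hA⟩ := NX.exists_add_le'
  obtain ⟨B, hB⟩ := NY.exists_add_le'
  obtain ⟨D, -, hD⟩ := exists_peetreK_add_le NX NY
  refine ⟨max 1 (max A (max B D)), le_max_left _ _, ?_, ?_, fun t ht => ?_⟩
  · exact QuasiAdd.mono (C := A) hA (by simp) NX.nonneg'
  · exact QuasiAdd.mono (C := B) hB (by simp) NY.nonneg'
  · exact QuasiAdd.mono (C := D) (fun x y => hD x y t ht) (by simp)
      fun x => peetreK_nonneg NX NY x ht

theorem peetreK_le (x : E) {t : ℝ} (ht : 0 ≤ t) (y : Y) :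
    peetreK NX NY x t ≤ NX (x - y) + t * NY y :=
  ciInf_le (peetreK_bdd NX NY x ht) y

theorem peetreK_le_left (x : E) {t : ℝ} (ht : 0 ≤ t) : peetreK NX NY x t ≤ NX x := by
  simpa [NY.map_zero'] using peetreK_le NX NY x ht 0

theorem peetreK_le_right (y : Y) {t : ℝ} (ht : 0 ≤ t) : peetreK NX NY (y : E) t ≤ t * NY y := by
  simpa [NX.map_zero'] using peetreK_le NX NY (y : E) ht y

theorem peetreK_mono (x : E) {t t' : ℝ} (ht : 0 ≤ t) (h : t ≤ t') :
    peetreK NX NY x t ≤ peetreK NX NY x t' :=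
  ciInf_mono (peetreK_bdd NX NY x ht) fun y =>
    add_le_add_right (mul_le_mul_of_nonneg_right h (NY.nonneg' y)) _

theorem exists_lt_of_peetreK_lt {x : E} {t r : ℝ} (h : peetreK NX NY x t < r) :
    ∃ y : Y, NX (x - y) + t * NY y < r :=
  exists_lt_of_ciInf_lt h

theorem peetreK_real_smul {r : ℝ} (hr : 0 ≤ r) (x : E) {t : ℝ} (ht : 0 ≤ t) :
    peetreK NX NY ((r : 𝕜) • x) t = r * peetreK NX NY x t := by
  rcases hr.eq_or_lt with rfl | hr
  · simp [peetreK_zero NX NY ht]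
  · apply le_antisymm
    · simpa [RCLike.norm_ofReal, abs_of_pos hr] using peetreK_smul_le NX NY (r : 𝕜) x ht
    · have h := peetreK_smul_le NX NY ((r⁻¹ : ℝ) : 𝕜) ((r : 𝕜) • x) ht
      rw [smul_smul, ← RCLike.ofReal_mul, inv_mul_cancel₀ hr.ne', RCLike.ofReal_one, one_smul,
        RCLike.norm_ofReal, abs_of_pos (inv_pos.2 hr)] at h
      rwa [le_inv_mul_iff₀ hr] at h

theorem peetreK_neg (x : E) {t : ℝ} (ht : 0 ≤ t) :
    peetreK NX NY (-x) t = peetreK NX NY x t := by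
  have h := fun x => peetreK_smul_le NX NY (-1 : 𝕜) x ht
  simp only [neg_smul, one_smul, norm_neg, norm_one, one_mul] at h
  exact le_antisymm (h x) (by simpa using h (-x))

end Peetre

/-! ### A criterion for closedness by successive approximation. -/

section Closed

variable {NX : QuasiNorm 𝕜 E} {Y : Submodule 𝕜 E} {NY : QuasiNorm 𝕜 Y}

/-- If, at some `t > 0`, the `K`-functional is much smaller than the ambient quasi-norm on all of
`Y`, then `Y` is closed. -/
theorem isClosedSet_of_peetreK_le (hY : NY.IsQuasiBanach) (hYX : NX.ContinuouslyEmbedded NY)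
    {C : ℝ} (hC : 1 ≤ C) (hX : QuasiAdd C NX) (hYC : QuasiAdd C NY) {t : ℝ} (ht : 0 < t)
    (h : ∀ u : Y, peetreK NX NY (u : E) t ≤ 1 / (20 * C ^ 3) * NX (u : E)) :
    NX.IsClosedSet (Y : Set E) := by
  intro v x hv hvx
  set η : ℝ := 1 / (20 * C ^ 3) with hη
  have hη0 : 0 < η := by positivity
  have hη1 : 20 * C ^ 3 * η = 1 := by rw [hη]; field_simp
  have hC2 : 1 ≤ C ^ 2 := one_le_pow₀ hC
  have hC3 : 1 ≤ C ^ 3 := one_le_pow₀ hC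
  have hη2 : η ≤ 1 := by nlinarith
  have hC0 : 0 < C := by linarith
  have happrox : ∀ ε : ℝ, 0 < ε → ∃ y : Y, NX (x - y) ≤ ε := by
    intro ε hε
    obtain ⟨n, hn⟩ := (hvx.eventually (gt_mem_nhds hε)).exists
    refine ⟨⟨v n, hv n⟩, ?_⟩
    rw [← NX.map_neg', neg_sub]
    exact hn.le
  -- One correction step: replace `x - z` by a nearby `y - z` in `Y` and split it by the
  -- `K`-functional. The error shrinks by `1 / (2 * C)`, and the correction has `Y`-size
  -- proportional to the old error, so the corrections sum in `Y`.
  have step : ∀ (ρ : ℝ), 0 < ρ → ∀ z : Y, NX (x - z) ≤ ρ →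
      ∃ w : Y, NX (x - (z + w : Y)) ≤ ρ * (1 / (2 * C)) ∧ NY w ≤ 4 * C * η / t * ρ := by
    intro ρ hρ z hz
    obtain ⟨y, hy⟩ := happrox (η * ρ) (by positivity)
    have hu : NX ((y - z : Y) : E) ≤ 2 * C * ρ := by
      have e : ((y - z : Y) : E) = (x - z) + -(x - y) := by push_cast; abel
      rw [e]
      refine (hX _ _).trans ?_
      rw [NX.map_neg']
      have : NX (x - z) + NX (x - y) ≤ 2 * ρ := by nlinarith
      nlinarith
    have hK : peetreK NX NY ((y - z : Y) : E) t < 4 * C * η * ρ := by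
      refine (h _).trans_lt ?_
      have : 0 < C * η * ρ := by positivity
      nlinarith
    obtain ⟨w, hw⟩ := exists_lt_of_peetreK_lt NX NY hK
    have hw1 : 0 ≤ NX (((y - z : Y) : E) - w) := NX.nonneg' _
    have hw2 : 0 ≤ t * NY w := mul_nonneg ht.le (NY.nonneg' _)
    refine ⟨w, ?_, ?_⟩
    · have e : x - ((z + w : Y) : E) = (x - y) + (((y - z : Y) : E) - w) := by push_cast; abel
      rw [e]
      refine (hX _ _).trans ?_
      have h1 : NX (x - y) + NX (((y - z : Y) : E) - w) ≤ 5 * C * η * ρ := by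
        have : 0 < η * ρ := by positivity
        nlinarith
      have h2 : C * (5 * C * η * ρ) ≤ ρ * (1 / (2 * C)) := by
        have : 1 / (2 * C) = 10 * C ^ 2 * η := by rw [hη]; field_simp; norm_num
        rw [this]
        have : 0 < C ^ 2 * η * ρ := by positivity
        nlinarith
      exact (mul_le_mul_of_nonneg_left h1 hC0.le).trans h2
    · rw [div_mul_eq_mul_div, le_div_iff₀ ht]
      linarith
  choose! W hW1 hW2 using step
  set R : ℝ := NX x + 1
  have hR : 0 < R := add_pos_of_nonneg_of_pos (NX.nonneg' _) one_pos
  set μ : ℝ := 1 / (2 * C) with hμ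
  have hμ0 : 0 < μ := by positivity
  obtain ⟨z, hz0, hzs⟩ : ∃ z : ℕ → Y, z 0 = 0 ∧ ∀ n, z (n + 1) = z n + W (R * μ ^ n) (z n) :=
    ⟨fun n => Nat.rec 0 (fun n z => z + W (R * μ ^ n) z) n, rfl, fun _ => rfl⟩
  have hz : ∀ n, NX (x - z n) ≤ R * μ ^ n := by
    intro n
    induction n with
    | zero => simp [hz0, R]
    | succ n ih =>
      have := hW1 (R * μ ^ n) (by positivity) (z n) ih
      rw [pow_succ, ← mul_assoc, hzs]
      exact this
  have hsum : ∀ n, ∑ i ∈ Finset.range n, W (R * μ ^ i) (z i) = z n := by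
    intro n
    induction n with
    | zero => simp [hz0]
    | succ n ih => rw [Finset.sum_range_succ, ih, hzs]
  obtain ⟨y, hy⟩ := hY.exists_tendsto_sum (C := C) hC hYC (w := fun n => W (R * μ ^ n) (z n))
    (L := 4 * C * η / t * R) (μ := μ) (by positivity) hμ0.le
    (by rw [hμ]; field_simp; exact le_rfl) (fun n => by
      have := hW2 (R * μ ^ n) (by positivity) (z n) (hz n)
      simpa [mul_assoc] using this)
  simp only [hsum] at hy
  have hμ1 : μ < 1 := by
    rw [hμ, div_lt_one (by positivity)]; linarith
  have h1 : Tendsto (fun n => NX ((z n : E) - x)) atTop (𝓝 0) := by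
    have hlim : Tendsto (fun n => R * μ ^ n) atTop (𝓝 0) := by
      simpa using (tendsto_pow_atTop_nhds_zero_of_lt_one hμ0.le hμ1).const_mul R
    refine squeeze_zero (fun n => NX.nonneg' _) (fun n => ?_) hlim
    rw [← NX.map_neg', neg_sub]
    exact hz n
  obtain ⟨M, hM⟩ := hYX
  have h2 : Tendsto (fun n => NX ((z n : E) - (y : E))) atTop (𝓝 0) := by
    refine squeeze_zero (fun n => NX.nonneg' _) (fun n => ?_) (by simpa using hy.const_mul M)
    have h3 := hM (z n - y)
    rwa [Submodule.coe_sub] at h3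
  rw [tendsto_unique' h1 h2]
  exact y.2

end Closed

end QuasiNorm

/-! ### Scales at which `K` and `J` are comparable. -/

namespace QuasiNorm

variable {𝕜 : Type*} [RCLike 𝕜] {E : Type*} [AddCommGroup E] [Module 𝕜 E]
variable {NX : QuasiNorm 𝕜 E} {Y : Submodule 𝕜 E} {NY : QuasiNorm 𝕜 Y}

/-- If at all small scales the `K`-functional is much smaller than the `J`-functional on `Y`, then
elements of `Y` have a `K`-functional that decays linearly, with a geometric-mean bound. -/
theorem peetreK_le_of_forall_lt {C : ℝ} (hC : 1 ≤ C) (hYC : QuasiAdd C NY) (hX : QuasiAdd C NX)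
    (hK : ∀ t : ℝ, 0 ≤ t → QuasiAdd C (fun x => peetreK NX NY x t)) {T : ℝ} (hT : 0 < T)
    (h : ∀ τ : ℝ, 0 < τ → τ < T → ∀ u : Y, NX (u : E) ≤ 1 → τ ^ 2 * NY u ≤ 1 →
      peetreK NX NY (u : E) (τ ^ 2) < 1 / (32 * C ^ 3))
    {σ : ℝ} (hσ : 0 < σ) {τ : ℝ} (hτ : 0 < τ) (u : Y) (hu1 : NX (u : E) ≤ 1)
    (hu2 : τ ^ 2 * NY u ≤ 1) : peetreK NX NY (u : E) (σ ^ 2) ≤ σ / τ * (σ / T) := by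
  have hC0 : 0 < C := by linarith
  -- The smallness threshold is `2 * C * e ^ 2`. With this `e`, the total loss `4 * C ^ 2 * e` in
  -- one splitting is exactly `1 / 2`.
  set e : ℝ := 1 / (8 * C ^ 2) with he
  have he0 : 0 < e := by positivity
  have he1 : 8 * C ^ 2 * e = 1 := by rw [he]; field_simp
  have hε : 1 / (32 * C ^ 3) = 2 * C * e ^ 2 := by rw [he]; field_simp; norm_num
  have hε1 : 2 * C * e ^ 2 ≤ 1 := by
    rw [← hε, div_le_one (by positivity)]
    have : 1 ≤ C ^ 3 := one_le_pow₀ hC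
    linarith
  have hlarge : ∀ τ : ℝ, 0 < τ → ∀ u : Y, τ ^ 2 * NY u ≤ 1 →
      peetreK NX NY (u : E) (σ ^ 2) ≤ (σ / τ) ^ 2 := fun τ hτ u hu => by
    refine (peetreK_le_right NX NY u (by positivity)).trans ?_
    rw [div_pow, le_div_iff₀ (by positivity)]
    nlinarith [sq_nonneg σ]
  -- The scales are squared so that `σ / τ` is the geometric mean of the trivial bounds `1` and `(σ
  -- / τ) ^ 2`. Each splitting halves the prefactor, down to the floor `σ / T` coming from scales `τ
  -- ≥ T`.
  have key : ∀ k : ℕ, ∀ τ : ℝ, 0 < τ → ∀ u : Y, NX (u : E) ≤ 1 → τ ^ 2 * NY u ≤ 1 →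
      peetreK NX NY (u : E) (σ ^ 2) ≤ σ / τ * max ((1 / 2) ^ k) (σ / T) := by
    intro k
    induction k with
    | zero =>
      intro τ hτ u hu1 hu2
      have h1 := hlarge τ hτ u hu2
      have h2 := (peetreK_le_left NX NY (u : E) (sq_nonneg σ)).trans hu1
      have h3 : σ / τ * 1 ≤ σ / τ * max ((1 / 2) ^ 0) (σ / T) :=
        mul_le_mul_of_nonneg_left (by simp) (by positivity)
      refine le_trans ?_ h3
      have h4 : 0 < σ / τ := by positivity
      rcases le_total (σ / τ) 1 with h5 | h5 <;> nlinarith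
    | succ k ih =>
      intro τ hτ u hu1 hu2
      rcases le_or_gt T τ with hTτ | hTτ
      · refine (hlarge τ hτ u hu2).trans ?_
        rw [sq]
        refine mul_le_mul_of_nonneg_left (le_max_of_le_right ?_) (by positivity)
        exact div_le_div_of_nonneg_left hσ.le hT hTτ
      · set b : ℝ := max ((1 / 2) ^ k) (σ / T) with hb
        obtain ⟨y, hy⟩ := exists_lt_of_peetreK_lt NX NY (h τ hτ hTτ u hu1 hu2)
        rw [hε] at hy
        have hy1 : 0 ≤ NX ((u : E) - y) := NX.nonneg' _
        have hy2 : 0 ≤ τ ^ 2 * NY y := mul_nonneg (sq_nonneg τ) (NY.nonneg' _)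
        -- The remainder `u - y` is small in `X`; divided by `2 * C * e ^ 2` it is admissible at the
        -- finer scale `e * τ`.
        have hx : peetreK NX NY ((u - y : Y) : E) (σ ^ 2)
            ≤ 2 * C * e ^ 2 * (σ / (e * τ) * b) := by
          have h1 : (u - y : Y) = ((2 * C * e ^ 2 : ℝ) : 𝕜) •
              (((2 * C * e ^ 2)⁻¹ : ℝ) : 𝕜) • (u - y : Y) := by
            rw [smul_smul, ← RCLike.ofReal_mul, mul_inv_cancel₀ (by positivity), RCLike.ofReal_one,
              one_smul]
          rw [h1, Submodule.coe_smul, peetreK_real_smul NX NY (by positivity) _ (by positivity)]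
          refine mul_le_mul_of_nonneg_left (ih _ (by positivity) _ ?_ ?_) (by positivity)
          · rw [Submodule.coe_smul, NX.map_real_smul (by positivity),
              inv_mul_le_one₀ (by positivity), Submodule.coe_sub]
            linarith
          · rw [NY.map_real_smul (by positivity)]
            have h2 : NY (u - y) ≤ C * (NY u + NY y) := by
              have := hYC u (-y)
              rwa [NY.map_neg', ← sub_eq_add_neg] at this
            have h3 : τ ^ 2 * NY (u - y) ≤ 2 * C := by
              have := mul_le_mul_of_nonneg_left h2 (sq_nonneg τ)
              nlinarith
            have e1 : (e * τ) ^ 2 * ((2 * C * e ^ 2)⁻¹ * NY (u - y))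
                = τ ^ 2 * NY (u - y) / (2 * C) := by field_simp
            rw [e1, div_le_one (by positivity)]
            exact h3
        -- The piece `y` is small in `Y`; divided by `2 * C` it is admissible at the coarser scale
        -- `τ / e`.
        have hy' : peetreK NX NY (y : E) (σ ^ 2) ≤ 2 * C * (σ / (τ / e) * b) := by
          have h1 : y = ((2 * C : ℝ) : 𝕜) • (((2 * C)⁻¹ : ℝ) : 𝕜) • y := by
            rw [smul_smul, ← RCLike.ofReal_mul, mul_inv_cancel₀ (by positivity), RCLike.ofReal_one,
              one_smul]
          rw [h1, Submodule.coe_smul, peetreK_real_smul NX NY (by positivity) _ (by positivity)]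
          refine mul_le_mul_of_nonneg_left (ih _ (by positivity) _ ?_ ?_) (by positivity)
          · rw [Submodule.coe_smul, NX.map_real_smul (by positivity),
              inv_mul_le_one₀ (by positivity)]
            have := hX u (-((u : E) - y))
            rw [NX.map_neg', show (u : E) + -((u : E) - y) = y by abel] at this
            nlinarith
          · rw [NY.map_real_smul (by positivity)]
            have e1 : (τ / e) ^ 2 * ((2 * C)⁻¹ * NY y) = τ ^ 2 * NY y / (2 * C * e ^ 2) := by
              field_simp
            rw [e1, div_le_one (by positivity)]
            linarith
        have hsum := hK (σ ^ 2) (by positivity) ((u - y : Y) : E) (y : E)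
        rw [Submodule.coe_sub, sub_add_cancel] at hsum
        rw [Submodule.coe_sub] at hx
        have hb2 : 1 / 2 * b ≤ max ((1 / 2) ^ (k + 1)) (σ / T) := by
          rw [hb, mul_max_of_nonneg _ _ (by norm_num)]
          refine max_le_max (by rw [pow_succ]; linarith) ?_
          have : 0 < σ / T := by positivity
          linarith
        refine hsum.trans ?_
        have e1 : C * (2 * C * e ^ 2 * (σ / (e * τ) * b) + 2 * C * (σ / (τ / e) * b))
            = σ / τ * (1 / 2 * b) * (8 * C ^ 2 * e) := by field_simp; ring
        calc _ ≤ C * (2 * C * e ^ 2 * (σ / (e * τ) * b) + 2 * C * (σ / (τ / e) * b)) :=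
              mul_le_mul_of_nonneg_left (add_le_add hx hy') hC0.le
          _ = σ / τ * (1 / 2 * b) := by rw [e1, he1, mul_one]
          _ ≤ _ := mul_le_mul_of_nonneg_left hb2 (by positivity)
  have hlim : Tendsto (fun k : ℕ => σ / τ * max ((1 / 2 : ℝ) ^ k) (σ / T)) atTop
      (𝓝 (σ / τ * max 0 (σ / T))) :=
    ((tendsto_pow_atTop_nhds_zero_of_lt_one (by norm_num) (by norm_num)).max
      tendsto_const_nhds).const_mul _
  rw [max_eq_right (by positivity)] at hlim
  exact ge_of_tendsto' hlim fun k => key k τ hτ u hu1 hu2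

/-- Homogeneity: normalise `u` in `X` and take `τ ^ 2 = NX u / NY u`, so that both admissibility
conditions hold with equality. -/
theorem peetreK_le_sqrt_mul {T : ℝ}
    (h : ∀ σ : ℝ, 0 < σ → ∀ τ : ℝ, 0 < τ → ∀ u : Y, NX (u : E) ≤ 1 → τ ^ 2 * NY u ≤ 1 →
      peetreK NX NY (u : E) (σ ^ 2) ≤ σ / τ * (σ / T))
    {s : ℝ} (hs : 0 < s) (u : Y) :
    peetreK NX NY (u : E) s ≤ s / T * √(NX (u : E) * NY u) := by
  rcases eq_or_ne u 0 with rfl | hu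
  · simp [peetreK_zero NX NY hs.le, NY.map_zero']
  have ha : 0 < NX (u : E) := lt_of_le_of_ne (NX.nonneg' _) fun h0 =>
    hu (Subtype.ext ((NX.eq_zero_iff' _).1 h0.symm))
  have hb : 0 < NY u := lt_of_le_of_ne (NY.nonneg' _) fun h0 => hu ((NY.eq_zero_iff' _).1 h0.symm)
  set p := √(NX (u : E)) with hp
  set q := √(NY u) with hq
  have hp0 : 0 < p := Real.sqrt_pos.2 ha
  have hq0 : 0 < q := Real.sqrt_pos.2 hb
  have hp2 : NX (u : E) = p ^ 2 := (Real.sq_sqrt ha.le).symm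
  have hq2 : NY u = q ^ 2 := (Real.sq_sqrt hb.le).symm
  have h1 := h (√s) (Real.sqrt_pos.2 hs) (p / q) (by positivity) ((((p ^ 2)⁻¹ : ℝ) : 𝕜) • u)
    (by rw [Submodule.coe_smul, NX.map_real_smul (by positivity), hp2,
          inv_mul_cancel₀ (by positivity)])
    (by rw [NY.map_real_smul (by positivity), hq2]; field_simp; exact le_rfl)
  rw [Real.sq_sqrt hs.le, Submodule.coe_smul, peetreK_real_smul NX NY (by positivity) _ hs.le,
    inv_mul_le_iff₀ (by positivity)] at h1
  rw [Real.sqrt_mul ha.le]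
  refine h1.trans_eq ?_
  rw [← hp, ← hq]
  field_simp
  rw [Real.sq_sqrt hs.le]

/-- Self-improvement: `NY u` may be replaced by `g = sup K(u, r) / r`, since near-optimal
approximants `w` of `u` have `NY w ≤ 2 * g`. The resulting `g ≤ F * √(a * g)` absorbs `g`, which is
finite because `g ≤ NY u`. -/
theorem exists_peetreK_le_mul {C : ℝ} (hC : 1 ≤ C) (hX : QuasiAdd C NX)
    (hK : ∀ t : ℝ, 0 ≤ t → QuasiAdd C (fun x => peetreK NX NY x t)) {T : ℝ} (hT : 0 < T)
    (h : ∀ s : ℝ, 0 < s → ∀ u : Y,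
      peetreK NX NY (u : E) s ≤ s / T * √(NX (u : E) * NY u)) :
    ∃ D : ℝ, 0 < D ∧ ∀ s : ℝ, 0 < s → ∀ u : Y,
      peetreK NX NY (u : E) s ≤ s * (D * NX (u : E)) := by
  have hC0 : 0 < C := by linarith
  set F : ℝ := C * (1 + 2 * C / T) with hF
  have hF0 : 0 < F := by positivity
  refine ⟨F ^ 2, by positivity, fun s hs u => ?_⟩
  set a := NX (u : E) with ha
  have ha0 : 0 ≤ a := NX.nonneg' _
  have hbdd : BddAbove (Set.range fun r : Set.Ioi (0 : ℝ) => peetreK NX NY (u : E) r / r) := by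
    refine ⟨NY u, ?_⟩
    rintro _ ⟨⟨r, hr⟩, rfl⟩
    have hr : 0 < r := hr
    change peetreK NX NY (u : E) r / r ≤ NY u
    rw [div_le_iff₀ hr, mul_comm]
    exact peetreK_le_right NX NY u hr.le
  set g := ⨆ r : Set.Ioi (0 : ℝ), peetreK NX NY (u : E) r / r with hg
  have hle : ∀ r : ℝ, 0 < r → peetreK NX NY (u : E) r ≤ r * g := fun r hr => by
    have := le_ciSup hbdd ⟨r, hr⟩
    rw [mul_comm]
    exact (div_le_iff₀ hr).1 this
  suffices hga : g ≤ F ^ 2 * a from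
    (hle s hs).trans (mul_le_mul_of_nonneg_left hga hs.le)
  rcases le_or_gt g 0 with hg0 | hg0
  · exact hg0.trans (by positivity)
  have ha1 : 0 < a := by
    refine lt_of_le_of_ne ha0 fun h0 => ?_
    have hu : (u : E) = 0 := (NX.eq_zero_iff' _).1 (ha ▸ h0.symm)
    have : g ≤ 0 := by
      have : Nonempty (Set.Ioi (0 : ℝ)) := ⟨⟨1, Set.mem_Ioi.2 one_pos⟩⟩
      refine ciSup_le fun r => ?_
      rw [hu, peetreK_zero NX NY (le_of_lt r.2), zero_div]
    linarith
  have hsq : 0 < √(a * g) := Real.sqrt_pos.2 (by positivity)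
  have hmain : ∀ s : ℝ, 0 < s → peetreK NX NY (u : E) s ≤ s * (F * √(a * g)) := by
    intro s hs
    -- The first entry keeps `NX w` comparable to `a`; the second makes the error `u - w` at most `s
    -- * √(a * g)` in `X`.
    set r := min (a / (2 * g)) (s * √(a * g) / (2 * g)) with hr
    have hr0 : 0 < r := lt_min (by positivity) (by positivity)
    have hr1 : 2 * r * g ≤ a := by
      have := (le_div_iff₀ (by positivity)).1 (min_le_left (a / (2 * g)) (s * √(a * g) / (2 * g)))
      linarith
    have hr2 : 2 * r * g ≤ s * √(a * g) := by
      have := (le_div_iff₀ (by positivity)).1 (min_le_right (a / (2 * g)) (s * √(a * g) / (2 * g)))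
      linarith
    have hlt : peetreK NX NY (u : E) r < 2 * r * g :=
      (hle r hr0).trans_lt (by nlinarith [mul_pos hr0 hg0])
    obtain ⟨w, hw⟩ := exists_lt_of_peetreK_lt NX NY hlt
    have hw1 : 0 ≤ NX ((u : E) - w) := NX.nonneg' _
    have hw2 : 0 ≤ r * NY w := mul_nonneg hr0.le (NY.nonneg' _)
    have hwY : NY w ≤ 2 * g := le_of_mul_le_mul_left (by linarith) hr0
    have hwX : NX (w : E) ≤ 2 * C * a := by
      have := hX u (-((u : E) - w))
      rw [NX.map_neg', show (u : E) + -((u : E) - w) = w by abel] at this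
      nlinarith
    have hsqrt : √(NX (w : E) * NY w) ≤ 2 * C * √(a * g) := by
      rw [Real.sqrt_le_left (by positivity), mul_pow, Real.sq_sqrt (by positivity)]
      have h1 : NX (w : E) * NY w ≤ 2 * C * a * (2 * g) :=
        mul_le_mul hwX hwY (NY.nonneg' _) (by positivity)
      have : 0 < a * g := by positivity
      nlinarith [mul_pos this hC0]
    have hKw : peetreK NX NY (w : E) s ≤ s / T * (2 * C * √(a * g)) :=
      (h s hs w).trans (mul_le_mul_of_nonneg_left hsqrt (by positivity))
    have hKd : peetreK NX NY ((u : E) - w) s ≤ s * √(a * g) :=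
      (peetreK_le_left NX NY _ hs.le).trans (by linarith)
    have hsum := hK s hs.le ((u : E) - w) w
    rw [sub_add_cancel] at hsum
    refine hsum.trans ((mul_le_mul_of_nonneg_left (add_le_add hKd hKw) hC0.le).trans_eq ?_)
    rw [hF]; ring
  have hgs : g ≤ F * √(a * g) := by
    have : Nonempty (Set.Ioi (0 : ℝ)) := ⟨⟨1, Set.mem_Ioi.2 one_pos⟩⟩
    refine ciSup_le fun r => ?_
    have hr : 0 < (r : ℝ) := r.2
    rw [div_le_iff₀ hr, mul_comm]
    exact hmain r hr
  have h1 : g ^ 2 ≤ F ^ 2 * (a * g) := by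
    have := pow_le_pow_left₀ hg0.le hgs 2
    rwa [mul_pow, Real.sq_sqrt (by positivity)] at this
  nlinarith

/-- If `Y` is not closed in `X`, then at arbitrarily small scales `t` there are elements of `Y`
whose `K`- and `J`-functionals are comparable. -/
theorem exists_le_peetreK_of_not_isClosedSet (hY : NY.IsQuasiBanach)
    (hYX : NX.ContinuouslyEmbedded NY) (hcl : ¬ NX.IsClosedSet (Y : Set E)) :
    ∃ c : ℝ, 0 < c ∧ ∀ T : ℝ, 0 < T → ∃ t : ℝ, 0 < t ∧ t < T ∧
      ∃ u : Y, NX (u : E) ≤ 1 ∧ t * NY u ≤ 1 ∧ c ≤ peetreK NX NY (u : E) t := by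
  obtain ⟨C, hC, hX, hYC, hK⟩ := exists_quasiAdd NX NY
  refine ⟨1 / (32 * C ^ 3), by positivity, ?_⟩
  by_contra! hcon
  obtain ⟨T, hT, hcon⟩ := hcon
  have hT' : 0 < √T := Real.sqrt_pos.2 hT
  have h1 := fun (σ : ℝ) (hσ : 0 < σ) (τ : ℝ) (hτ : 0 < τ) =>
    peetreK_le_of_forall_lt hC hYC hX hK hT'
      (fun τ hτ hτT u hu1 hu2 => hcon (τ ^ 2) (by positivity) ((Real.lt_sqrt hτ.le).1 hτT) u hu1 hu2)
      hσ hτ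
  have h2 := fun (s : ℝ) (hs : 0 < s) (u : Y) => peetreK_le_sqrt_mul h1 hs u
  obtain ⟨D, hD, h3⟩ := exists_peetreK_le_mul hC hX hK hT' h2
  -- With this `t` the factor `t * D` equals the threshold `1 / (20 * C ^ 3)` of the closedness
  -- criterion.
  refine hcl (isClosedSet_of_peetreK_le hY hYX hC hX hYC (t := 1 / (20 * C ^ 3) / D)
    (by positivity) fun u => (h3 _ (by positivity) u).trans_eq ?_)
  field_simp

end QuasiNorm

/-! ### Lacunary sums. -/

theorem sum_Ico_le_of_le_mul {e : ℕ → ℝ} (he : ∀ n, 0 ≤ e n) {r : ℝ} (hr : r ≤ 1 / 2)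
    (h : ∀ n, e (n + 1) ≤ r * e n) (n N : ℕ) :
    ∑ m ∈ Finset.Ico (n + 1) N, e m ≤ 2 * r * e n := by
  have key : ∀ k, ∑ m ∈ Finset.Ico (n + 1) (n + 1 + k), e m + 2 * e (n + 1 + k) ≤ 2 * r * e n := by
    intro k
    induction k with
    | zero => have := h n; simp; linarith
    | succ k ih =>
      rw [← add_assoc, Finset.sum_Ico_succ_top (by omega)]
      have h1 := h (n + 1 + k)
      have h2 := he (n + 1 + k)
      nlinarith
  rcases le_total (n + 1) N with hN | hN
  · obtain ⟨k, rfl⟩ := Nat.exists_eq_add_of_le hN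
    have h1 := key k
    have h2 := he (n + 1 + k)
    linarith
  · rw [Finset.Ico_eq_empty_of_le hN, Finset.sum_empty]
    have h1 := h n
    have h2 := he (n + 1)
    linarith

theorem sum_range_le_of_le_mul {f : ℕ → ℝ} (hf : ∀ n, 0 ≤ f n) {r : ℝ} (hr0 : 0 ≤ r)
    (hr : r ≤ 1 / 2) (h : ∀ n, f n ≤ r * f (n + 1)) (n : ℕ) :
    ∑ m ∈ Finset.range n, f m ≤ 2 * r * f n := by
  induction n with
  | zero => have := hf 0; simp; positivity
  | succ n ih =>
    rw [Finset.sum_range_succ]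
    have h1 := h n
    have h2 := hf n
    nlinarith

namespace QuasiNorm

variable {𝕜 : Type*} [RCLike 𝕜] {E : Type*} [AddCommGroup E] [Module 𝕜 E]
variable {NX : QuasiNorm 𝕜 E} {Y : Submodule 𝕜 E} {NY : QuasiNorm 𝕜 Y}

/-- Lacunary sums: if `u n` has comparable `K`- and `J`-functionals at the scale `t n`, and the
coefficients `b n` grow and decay fast enough, then `∑ b n • u n` has a `K`-functional at `t n`
of size `b n`, and it is controlled by the individual terms at all other scales. -/
theorem exists_lacunary_sum (hXB : NX.IsQuasiBanach) {C : ℝ} (hC : 1 ≤ C) (hX : QuasiAdd C NX)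
    (hK : ∀ t : ℝ, 0 ≤ t → QuasiAdd C (fun x => peetreK NX NY x t)) {ρ : ℝ} (hρ : 0 < ρ)
    (hKρ : ∀ t : ℝ, 0 ≤ t → ∀ (s : Finset ℕ) (x : ℕ → E),
      peetreK NX NY (∑ i ∈ s, x i) t ^ ρ ≤ 2 * ∑ i ∈ s, peetreK NX NY (x i) t ^ ρ)
    {c : ℝ} (hc : 0 < c) {t b : ℕ → ℝ} (ht : ∀ n, 0 < t n) (hb : ∀ n, 0 < b n) {u : ℕ → Y}
    (hu1 : ∀ n, NX (u n : E) ≤ 1) (hu2 : ∀ n, t n * NY (u n) ≤ 1)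
    (hu3 : ∀ n, c ≤ peetreK NX NY (u n : E) (t n)) {μ : ℝ} (hμ0 : 0 < μ) (hμ1 : 2 * C * μ ≤ 1)
    (hμ2 : μ ^ ρ ≤ 1 / 2) (hμ3 : 8 * μ ^ ρ ≤ (c / (4 * C ^ 2)) ^ ρ)
    (hb1 : ∀ n, b (n + 1) ≤ μ * b n) (hb2 : ∀ n, b n / t n ≤ μ * (b (n + 1) / t (n + 1))) :
    ∃ x : E, (∀ n, c / (2 * C) * b n ≤ peetreK NX NY x (t n)) ∧
      ∀ s : ℝ, 0 < s → ∀ M : ℝ, 0 ≤ M →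
        (∀ N : ℕ, ∑ m ∈ Finset.range N, (b m * min 1 (s / t m)) ^ ρ ≤ M) →
        peetreK NX NY x s ≤ C * (2 * M) ^ ρ⁻¹ := by
  have hC0 : 0 < C := by linarith
  set w : ℕ → E := fun n => ((b n : ℝ) : 𝕜) • (u n : E) with hw
  have hbn : ∀ n, b n ≤ b 0 * μ ^ n := by
    intro n
    induction n with
    | zero => simp
    | succ n ih =>
      rw [pow_succ]
      nlinarith [hb1 n]
  have hwX : ∀ n, NX (w n) ≤ b n := fun n => by
    rw [hw]; dsimp only
    rw [NX.map_real_smul (hb n).le]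
    exact mul_le_of_le_one_right (hb n).le (hu1 n)
  have hwK : ∀ n s, 0 < s → peetreK NX NY (w n) s ≤ b n * min 1 (s / t n) := fun n s hs => by
    rw [hw]; dsimp only
    rw [peetreK_real_smul NX NY (hb n).le _ hs.le]
    refine mul_le_mul_of_nonneg_left (le_min ?_ ?_) (hb n).le
    · exact (peetreK_le_left NX NY _ hs.le).trans (hu1 n)
    · refine (peetreK_le_right NX NY (u n) hs.le).trans ?_
      rw [le_div_iff₀ (ht n), mul_assoc, mul_comm (NY (u n))]
      exact mul_le_of_le_one_right hs.le (hu2 n)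
  obtain ⟨x, hx⟩ := hXB.exists_tendsto_sum hC hX (hb 0).le hμ0.le hμ1
    fun n => (hwX n).trans (hbn n)
  set S : ℕ → E := fun N => ∑ i ∈ Finset.range N, w i with hS
  have hx' : Tendsto (fun N => NX (x - S N)) atTop (𝓝 0) := by
    refine hx.congr fun N => ?_
    rw [← NX.map_neg', neg_sub]
  refine ⟨x, fun n => ?_, fun s hs M hM0 hM => ?_⟩
  · have hbn0 := hb n
    obtain ⟨N, hN, hnN⟩ := ((hx'.eventually (gt_mem_nhds (show 0 < c / (4 * C ^ 2) * b n by
      positivity))).and (eventually_gt_atTop n)).exists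
    have htn := ht n
    -- Terms before `n` are controlled by `t n * (b i / t i)`, terms after `n` by `b i`. Both sums
    -- are geometric and dominated by their end at `n`; together with the factor `2` of `hKρ` they
    -- give `8 * μ ^ ρ`.
    have hrest : peetreK NX NY (∑ i ∈ (Finset.range N).erase n, w i) (t n)
        ≤ c / (4 * C ^ 2) * b n := by
      have h1 := hKρ (t n) htn.le ((Finset.range N).erase n) w
      have h2 : ∑ i ∈ (Finset.range N).erase n, peetreK NX NY (w i) (t n) ^ ρ
          ≤ ∑ i ∈ (Finset.range N).erase n, (b i * min 1 (t n / t i)) ^ ρ :=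
        Finset.sum_le_sum fun i _ => Real.rpow_le_rpow (peetreK_nonneg NX NY _ htn.le)
          (hwK i _ htn) hρ.le
      have h3 : ∑ i ∈ (Finset.range N).erase n, (b i * min 1 (t n / t i)) ^ ρ
          = ∑ i ∈ Finset.range n, (b i * min 1 (t n / t i)) ^ ρ
            + ∑ i ∈ Finset.Ico (n + 1) N, (b i * min 1 (t n / t i)) ^ ρ := by
        have e1 := Finset.add_sum_erase (Finset.range N)
          (fun i => (b i * min 1 (t n / t i)) ^ ρ) (Finset.mem_range.2 hnN)
        have e2 := Finset.sum_range_add_sum_Ico (fun i => (b i * min 1 (t n / t i)) ^ ρ)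
          (show n + 1 ≤ N from hnN)
        rw [Finset.sum_range_succ] at e2
        linarith
      have h4 : ∑ i ∈ Finset.range n, (b i * min 1 (t n / t i)) ^ ρ ≤ 2 * μ ^ ρ * b n ^ ρ := by
        have h5 := sum_range_le_of_le_mul (f := fun i => (b i / t i) ^ ρ)
          (fun i => Real.rpow_nonneg (div_pos (hb i) (ht i)).le _) (Real.rpow_nonneg hμ0.le ρ) hμ2
          (fun i => by
            rw [← Real.mul_rpow hμ0.le (div_pos (hb _) (ht _)).le]
            exact Real.rpow_le_rpow (div_pos (hb i) (ht i)).le (hb2 i) hρ.le) n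
        calc _ ≤ ∑ i ∈ Finset.range n, t n ^ ρ * (b i / t i) ^ ρ := by
              refine Finset.sum_le_sum fun i _ => ?_
              have hbi := hb i
              have hti := ht i
              rw [← Real.mul_rpow htn.le (by positivity)]
              refine Real.rpow_le_rpow (by positivity) ?_ hρ.le
              refine (mul_le_mul_of_nonneg_left (min_le_right _ _) hbi.le).trans_eq ?_
              field_simp
          _ = t n ^ ρ * ∑ i ∈ Finset.range n, (b i / t i) ^ ρ := by rw [Finset.mul_sum]
          _ ≤ t n ^ ρ * (2 * μ ^ ρ * (b n / t n) ^ ρ) :=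
              mul_le_mul_of_nonneg_left h5 (Real.rpow_nonneg htn.le _)
          _ = 2 * μ ^ ρ * (t n * (b n / t n)) ^ ρ := by
              rw [Real.mul_rpow htn.le (by positivity)]; ring
          _ = _ := by rw [mul_div_cancel₀ _ htn.ne']
      have h6 : ∑ i ∈ Finset.Ico (n + 1) N, (b i * min 1 (t n / t i)) ^ ρ
          ≤ 2 * μ ^ ρ * b n ^ ρ := by
        have h5 := sum_Ico_le_of_le_mul (e := fun i => b i ^ ρ)
          (fun i => Real.rpow_nonneg (hb i).le _) hμ2
          (fun i => by
            rw [← Real.mul_rpow hμ0.le (hb i).le]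
            exact Real.rpow_le_rpow (hb _).le (hb1 i) hρ.le) n N
        refine le_trans (Finset.sum_le_sum fun i _ => ?_) h5
        have hbi := hb i
        have hti := ht i
        exact Real.rpow_le_rpow (by positivity) (mul_le_of_le_one_right hbi.le (min_le_left _ _))
          hρ.le
      have hbρ : 0 ≤ b n ^ ρ := Real.rpow_nonneg (hb n).le _
      have h7 : peetreK NX NY (∑ i ∈ (Finset.range N).erase n, w i) (t n) ^ ρ
          ≤ (c / (4 * C ^ 2) * b n) ^ ρ := by
        rw [Real.mul_rpow (by positivity) (hb n).le]
        nlinarith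
      exact (Real.rpow_le_rpow_iff (peetreK_nonneg NX NY _ htn.le) (by positivity) hρ).1 h7
    have hwn : c * b n ≤ peetreK NX NY (w n) (t n) := by
      rw [hw]; dsimp only
      rw [peetreK_real_smul NX NY (hb n).le _ htn.le, mul_comm c]
      exact mul_le_mul_of_nonneg_left (hu3 n) (hb n).le
    have hsplit : w n = x + (-(x - S N) + -(∑ i ∈ (Finset.range N).erase n, w i)) := by
      have := Finset.add_sum_erase (Finset.range N) w (Finset.mem_range.2 hnN)
      rw [hS]; dsimp only
      rw [← this]; abel
    have h1 := hK (t n) htn.le x (-(x - S N) + -(∑ i ∈ (Finset.range N).erase n, w i))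
    have h2 := hK (t n) htn.le (-(x - S N)) (-(∑ i ∈ (Finset.range N).erase n, w i))
    dsimp only at h1 h2
    rw [← hsplit] at h1
    rw [peetreK_neg NX NY _ htn.le, peetreK_neg NX NY _ htn.le] at h2
    have h3 := peetreK_le_left NX NY (x - S N) htn.le
    have h4 : C * (peetreK NX NY (x - S N) (t n)
        + peetreK NX NY (∑ i ∈ (Finset.range N).erase n, w i) (t n))
        ≤ C * (2 * (c / (4 * C ^ 2) * b n)) := mul_le_mul_of_nonneg_left (by linarith) hC0.le
    have h5 : C * (2 * (c / (4 * C ^ 2) * b n)) = c / (2 * C) * b n := by field_simp; norm_num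
    have h6 : c * b n ≤ C * (peetreK NX NY x (t n) + c / (2 * C) * b n) :=
      (hwn.trans h1).trans (mul_le_mul_of_nonneg_left (by linarith) hC0.le)
    have h7 : c * b n = C * (2 * (c / (2 * C) * b n)) := by field_simp
    rw [h7] at h6
    have := le_of_mul_le_mul_left h6 hC0
    linarith
  · have hKS : ∀ N, peetreK NX NY (S N) s ≤ (2 * M) ^ ρ⁻¹ := by
      intro N
      rw [Real.le_rpow_inv_iff_of_pos (peetreK_nonneg NX NY _ hs.le) (by positivity) hρ]
      refine (hKρ s hs.le _ _).trans (mul_le_mul_of_nonneg_left ((Finset.sum_le_sum fun i _ =>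
        ?_).trans (hM N)) zero_le_two)
      exact Real.rpow_le_rpow (peetreK_nonneg NX NY _ hs.le) (hwK i s hs) hρ.le
    have hlim : Tendsto (fun N => C * ((2 * M) ^ ρ⁻¹ + NX (x - S N))) atTop
        (𝓝 (C * ((2 * M) ^ ρ⁻¹ + 0))) := (hx'.const_add _).const_mul C
    rw [add_zero] at hlim
    refine ge_of_tendsto' hlim fun N => ?_
    have h1 := hK s hs.le (S N) (x - S N)
    dsimp only at h1
    rw [add_sub_cancel] at h1
    exact h1.trans (mul_le_mul_of_nonneg_left
      (add_le_add (hKS N) (peetreK_le_left NX NY _ hs.le)) hC0.le)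

end QuasiNorm

/-! ### Interpolation spaces: membership tests and inclusions. -/

namespace QuasiNorm

variable {𝕜 : Type*} [RCLike 𝕜] {E : Type*} [AddCommGroup E] [Module 𝕜 E]
variable {NX : QuasiNorm 𝕜 E} {Y : Submodule 𝕜 E} {NY : QuasiNorm 𝕜 Y}

theorem mem_interp {θ : ℝ} {q : ℝ≥0∞} {x : E} :
    x ∈ NX.interp NY θ q ↔ interpFunctional NX NY θ q x < ∞ := Iff.rfl

theorem mem_interp_iff_lintegral {θ : ℝ} {q : ℝ≥0∞} (hq0 : q ≠ 0) (hqt : q ≠ ∞) {x : E} :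
    x ∈ NX.interp NY θ q ↔ ∫⁻ t in Set.Ioi (0 : ℝ),
      ENNReal.ofReal (t ^ (-(θ * q.toReal + 1)) * peetreK NX NY x t ^ q.toReal) < ∞ := by
  have hq : 0 < q.toReal := ENNReal.toReal_pos hq0 hqt
  rw [mem_interp, interpFunctional, eLpNorm_lt_top_iff_lintegral_rpow_enorm_lt_top hq0 hqt,
    setLIntegral_congr_fun measurableSet_Ioi fun t (ht : 0 < t) => ?_]
  have hKt := peetreK_nonneg NX NY x ht.le
  rw [Real.enorm_of_nonneg (by positivity), ENNReal.ofReal_rpow_of_nonneg (by positivity) hq.le,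
    Real.mul_rpow (by positivity) hKt, ← Real.rpow_mul ht.le, ENNReal.toReal_inv]
  congr 3
  field_simp

theorem mem_interp_top {θ : ℝ} {x : E} {D : ℝ}
    (h : ∀ t : ℝ, 0 < t → peetreK NX NY x t ≤ D * t ^ θ) : x ∈ NX.interp NY θ ∞ := by
  rw [mem_interp, interpFunctional, eLpNorm_exponent_top]
  refine eLpNormEssSup_lt_top_of_ae_bound (C := D) ?_
  filter_upwards [ae_restrict_mem measurableSet_Ioi] with t (ht : 0 < t)
  have hKt := peetreK_nonneg NX NY x ht.le
  rw [Real.norm_of_nonneg (by positivity), ENNReal.inv_top, ENNReal.toReal_zero, add_zero,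
    Real.rpow_neg ht.le, inv_mul_le_iff₀ (by positivity), mul_comm]
  exact h t ht

/-- On a dyadic interval `K` is at least its left value and the power weight at least its right
value, so a pointwise value of `K` costs only a local integral. -/
theorem ofReal_le_setLIntegral_Ioc {θ q : ℝ} (hθ : 0 ≤ θ) (hq : 0 ≤ q) (x : E) {t : ℝ}
    (ht : 0 < t) :
    ENNReal.ofReal (2 ^ (-(θ * q + 1)) * (t ^ (-(θ * q)) * peetreK NX NY x t ^ q)) ≤
      ∫⁻ s in Set.Ioc t (2 * t),
        ENNReal.ofReal (s ^ (-(θ * q + 1)) * peetreK NX NY x s ^ q) := by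
  have hKt := peetreK_nonneg NX NY x ht.le
  calc ENNReal.ofReal (2 ^ (-(θ * q + 1)) * (t ^ (-(θ * q)) * peetreK NX NY x t ^ q))
      = ENNReal.ofReal ((2 * t) ^ (-(θ * q + 1)) * peetreK NX NY x t ^ q) *
          volume (Set.Ioc t (2 * t)) := by
        rw [Real.volume_Ioc, ← ENNReal.ofReal_mul (by positivity)]
        congr 1
        rw [Real.mul_rpow zero_le_two ht.le, show -(θ * q) = -(θ * q + 1) + 1 by ring,
          Real.rpow_add_one ht.ne']
        ring
    _ = ∫⁻ _ in Set.Ioc t (2 * t),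
          ENNReal.ofReal ((2 * t) ^ (-(θ * q + 1)) * peetreK NX NY x t ^ q) := by
        rw [setLIntegral_const]
    _ ≤ _ := by
        refine setLIntegral_mono' measurableSet_Ioc fun s hs => ENNReal.ofReal_le_ofReal ?_
        have hs0 : 0 < s := ht.trans hs.1
        refine mul_le_mul ?_ (Real.rpow_le_rpow hKt (peetreK_mono NX NY x ht.le hs.1.le) hq)
          (by positivity) (by positivity)
        have : 0 ≤ θ * q := mul_nonneg hθ hq
        exact Real.rpow_le_rpow_of_nonpos hs0 hs.2 (by linarith)

/-- Along a lacunary sequence, the `K`-functional of an element of `(X, Y)_{θ,q}` is in a weighted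
`ℓ^q`. -/
theorem summable_of_mem_interp {θ : ℝ} (hθ : 0 ≤ θ) {q : ℝ≥0∞} (hq0 : q ≠ 0) (hqt : q ≠ ∞) {x : E}
    (hx : x ∈ NX.interp NY θ q) {t : ℕ → ℝ} (ht : ∀ n, 0 < t n)
    (ht2 : ∀ n, 2 * t (n + 1) ≤ t n) :
    Summable fun n => t n ^ (-(θ * q.toReal)) * peetreK NX NY x (t n) ^ q.toReal := by
  have hq : 0 < q.toReal := ENNReal.toReal_pos hq0 hqt
  have hanti : Antitone t := antitone_nat_of_succ_le fun n => by
    have := ht2 n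
    have := ht (n + 1)
    linarith
  rw [mem_interp_iff_lintegral hq0 hqt] at hx
  have hdisj : Pairwise (Function.onFun Disjoint fun n => Set.Ioc (t n) (2 * t n)) := by
    rw [(symm_disjoint.comap _).pairwise_on]
    intro m n hmn
    rw [Function.onFun, Set.disjoint_left]
    intro s hs hs'
    have h1 := hanti (Nat.succ_le_of_lt hmn)
    have h2 := ht2 m
    have := hs.1
    have := hs'.2
    simp only [Nat.succ_eq_add_one] at h1
    linarith
  have hsum : ∑' n, ENNReal.ofReal (2 ^ (-(θ * q.toReal + 1)) *
      (t n ^ (-(θ * q.toReal)) * peetreK NX NY x (t n) ^ q.toReal)) < ∞ := by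
    refine lt_of_le_of_lt (ENNReal.tsum_le_tsum fun n =>
      ofReal_le_setLIntegral_Ioc hθ hq.le x (ht n)) ?_
    rw [← lintegral_iUnion (fun _ => measurableSet_Ioc) hdisj]
    refine lt_of_le_of_lt (lintegral_mono_set ?_) hx
    exact Set.iUnion_subset fun n s hs => (ht n).trans hs.1
  have h1 := ENNReal.summable_toReal hsum.ne
  have hnn : ∀ n, 0 ≤ t n ^ (-(θ * q.toReal)) * peetreK NX NY x (t n) ^ q.toReal := fun n =>
    mul_nonneg (Real.rpow_nonneg (ht n).le _)
      (Real.rpow_nonneg (peetreK_nonneg NX NY x (ht n).le) _)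
  have h2 : (0 : ℝ) < 2 ^ (-(θ * q.toReal + 1)) := by positivity
  simp only [fun n => ENNReal.toReal_ofReal (mul_nonneg h2.le (hnn n))] at h1
  exact (summable_mul_left_iff h2.ne').1 h1

/-- `(X, Y)_{θ,q} ⊆ (X, Y)_{θ,∞}`. -/
theorem exists_peetreK_le_of_mem_interp {θ : ℝ} (hθ : 0 ≤ θ) {q : ℝ≥0∞} (hq : 0 < q) {x : E}
    (hx : x ∈ NX.interp NY θ q) :
    ∃ D : ℝ, 0 < D ∧ ∀ t : ℝ, 0 < t → peetreK NX NY x t ≤ D * t ^ θ := by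
  rcases eq_or_ne q ∞ with rfl | hqt
  · rw [mem_interp, interpFunctional, eLpNorm_exponent_top] at hx
    have hae := ae_le_eLpNormEssSup (μ := volume.restrict (Set.Ioi (0 : ℝ)))
      (f := fun t : ℝ => t ^ (-(θ + ((∞ : ℝ≥0∞)⁻¹).toReal)) * peetreK NX NY x t)
    set M := eLpNormEssSup (fun t : ℝ => t ^ (-(θ + ((∞ : ℝ≥0∞)⁻¹).toReal)) * peetreK NX NY x t)
      (volume.restrict (Set.Ioi (0 : ℝ)))
    refine ⟨(M.toReal + 1) * 2 ^ θ, by positivity, fun t ht => ?_⟩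
    rw [ae_restrict_iff' measurableSet_Ioi] at hae
    obtain ⟨s, hs, hs'⟩ : ∃ s ∈ Set.Ioc t (2 * t), s ∈ Set.Ioi (0 : ℝ) →
        ‖s ^ (-(θ + ((∞ : ℝ≥0∞)⁻¹).toReal)) * peetreK NX NY x s‖ₑ ≤ M := by
      by_contra! hcon
      have h0 : volume (Set.Ioc t (2 * t)) = 0 :=
        measure_mono_null (fun s hs => by simpa using hcon s hs) hae
      rw [Real.volume_Ioc, ENNReal.ofReal_eq_zero] at h0
      linarith
    have hs0 : 0 < s := ht.trans hs.1
    have hKs := peetreK_nonneg NX NY x hs0.le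
    have h1 := hs' hs0
    rw [Real.enorm_of_nonneg (by positivity), ENNReal.ofReal_le_iff_le_toReal hx.ne,
      ENNReal.inv_top, ENNReal.toReal_zero, add_zero, Real.rpow_neg hs0.le,
      inv_mul_le_iff₀ (by positivity)] at h1
    calc peetreK NX NY x t ≤ peetreK NX NY x s := peetreK_mono NX NY x ht.le hs.1.le
      _ ≤ s ^ θ * M.toReal := h1
      _ ≤ (2 * t) ^ θ * (M.toReal + 1) :=
          mul_le_mul (Real.rpow_le_rpow hs0.le hs.2 hθ) (by linarith) ENNReal.toReal_nonneg
            (by positivity)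
      _ = _ := by rw [Real.mul_rpow zero_le_two ht.le]; ring
  · have hq0 := ENNReal.toReal_pos hq.ne' hqt
    rw [mem_interp_iff_lintegral hq.ne' hqt] at hx
    set I := ∫⁻ t in Set.Ioi (0 : ℝ),
      ENNReal.ofReal (t ^ (-(θ * q.toReal + 1)) * peetreK NX NY x t ^ q.toReal)
    refine ⟨(2 ^ (θ * q.toReal + 1) * (I.toReal + 1)) ^ q.toReal⁻¹, by positivity, fun t ht => ?_⟩
    have hKt := peetreK_nonneg NX NY x ht.le
    have h1 := (ofReal_le_setLIntegral_Ioc (NX := NX) (NY := NY) hθ hq0.le x ht).trans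
      (lintegral_mono_set (fun s hs => ht.trans hs.1) : _ ≤ I)
    rw [ENNReal.ofReal_le_iff_le_toReal hx.ne, Real.rpow_neg zero_le_two, Real.rpow_neg ht.le,
      inv_mul_le_iff₀ (by positivity), inv_mul_le_iff₀ (by positivity)] at h1
    rw [← Real.rpow_le_rpow_iff hKt (by positivity) hq0, Real.mul_rpow (by positivity)
      (by positivity), Real.rpow_inv_rpow (by positivity) hq0.ne', ← Real.rpow_mul ht.le]
    refine h1.trans ?_
    rw [mul_comm]
    refine mul_le_mul_of_nonneg_right ?_ (by positivity)
    exact mul_le_mul_of_nonneg_left (by linarith) (by positivity)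

/-- Only small `t` matter: beyond `1` the bound `K ≤ NX x` suffices because `θ > 0`, while near `0`
the gain `σ - θ > 0` gives convergence. -/
theorem mem_interp_of_peetreK_le {θ σ : ℝ} (hθ : 0 < θ) (hσ : θ < σ) {q : ℝ≥0∞} (hq : 0 < q)
    {x : E} {D : ℝ} (h : ∀ t : ℝ, 0 < t → t ≤ 1 → peetreK NX NY x t ≤ D * t ^ σ) :
    x ∈ NX.interp NY θ q := by
  have hD : 0 ≤ D := by
    have := (peetreK_nonneg NX NY x zero_le_one).trans (h 1 one_pos le_rfl)
    simpa using this
  have hN := NX.nonneg' x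
  rcases eq_or_ne q ∞ with rfl | hqt
  · refine mem_interp_top (D := D + NX x) fun t ht => ?_
    rcases le_total t 1 with ht1 | ht1
    · refine (h t ht ht1).trans (mul_le_mul (by linarith) ?_ (by positivity) (by positivity))
      exact Real.rpow_le_rpow_of_exponent_ge ht ht1 hσ.le
    · have h1 := Real.one_le_rpow ht1 hθ.le
      have h2 := peetreK_le_left NX NY x ht.le
      nlinarith
  · have hq0 := ENNReal.toReal_pos hq.ne' hqt
    rw [mem_interp_iff_lintegral hq.ne' hqt]
    set r := q.toReal
    rw [← Set.Ioc_union_Ioi_eq_Ioi zero_le_one]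
    refine (lintegral_union_le _ _ _).trans_lt (ENNReal.add_lt_top.2 ⟨?_, ?_⟩)
    · have hint : IntegrableOn (fun t : ℝ => D ^ r * t ^ ((σ - θ) * r - 1)) (Set.Ioc 0 1) := by
        refine Integrable.const_mul ?_ _
        have : -1 < (σ - θ) * r - 1 := by nlinarith
        exact (intervalIntegrable_iff_integrableOn_Ioc_of_le zero_le_one).1
          (intervalIntegral.intervalIntegrable_rpow' this)
      refine lt_of_le_of_lt (setLIntegral_mono' measurableSet_Ioc fun t ht =>
        ENNReal.ofReal_le_ofReal ?_) hint.lintegral_lt_top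
      have ht0 : 0 < t := ht.1
      calc t ^ (-(θ * r + 1)) * peetreK NX NY x t ^ r ≤ t ^ (-(θ * r + 1)) * (D * t ^ σ) ^ r :=
            mul_le_mul_of_nonneg_left (Real.rpow_le_rpow (peetreK_nonneg NX NY x ht0.le)
              (h t ht0 ht.2) hq0.le) (by positivity)
        _ = _ := by
            rw [Real.mul_rpow hD (by positivity), ← Real.rpow_mul ht0.le, mul_left_comm,
              ← Real.rpow_add ht0]
            congr 2
            ring
    · have hint : IntegrableOn (fun t : ℝ => NX x ^ r * t ^ (-(θ * r + 1))) (Set.Ioi 1) :=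
        (integrableOn_Ioi_rpow_of_lt (by nlinarith) one_pos).const_mul _
      refine lt_of_le_of_lt (setLIntegral_mono' measurableSet_Ioi fun t (ht : 1 < t) =>
        ENNReal.ofReal_le_ofReal ?_) hint.lintegral_lt_top
      have ht0 : 0 < t := one_pos.trans ht
      rw [mul_comm]
      exact mul_le_mul_of_nonneg_right (Real.rpow_le_rpow (peetreK_nonneg NX NY x ht0.le)
        (peetreK_le_left NX NY x ht0.le) hq0.le) (by positivity)

theorem le_interp {θ : ℝ} (hθ : θ ∈ Set.Ioo (0 : ℝ) 1) {q : ℝ≥0∞} (hq : 0 < q) :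
    Y ≤ NX.interp NY θ q := fun y hy =>
  mem_interp_of_peetreK_le hθ.1 hθ.2 hq (D := NY ⟨y, hy⟩) fun t ht _ => by
    rw [Real.rpow_one, mul_comm]
    exact peetreK_le_right NX NY ⟨y, hy⟩ ht.le

theorem interp_le_interp {θ θ' : ℝ} (hθ : 0 < θ) (hθ' : θ < θ') {p q : ℝ≥0∞} (hp : 0 < p)
    (hq : 0 < q) : NX.interp NY θ' p ≤ NX.interp NY θ q := fun _ hx =>
  let ⟨_, _, hD⟩ := exists_peetreK_le_of_mem_interp (hθ.trans hθ').le hp hx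
  mem_interp_of_peetreK_le hθ hθ' hq fun t ht _ => hD t ht

theorem interp_eq_of_isClosedSet (hcl : NX.IsClosedSet (Y : Set E)) {θ : ℝ}
    (hθ : θ ∈ Set.Ioo (0 : ℝ) 1) {q : ℝ≥0∞} (hq : 0 < q) : NX.interp NY θ q = Y := by
  refine le_antisymm (fun x hx => ?_) (le_interp hθ hq)
  obtain ⟨D, hD0, hD⟩ := exists_peetreK_le_of_mem_interp hθ.1.le hq hx
  have hlim : Tendsto (fun n : ℕ => 2 * D * ((1 : ℝ) / ((n : ℝ) + 1)) ^ θ) atTop (𝓝 0) := by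
    have := (tendsto_one_div_add_atTop_nhds_zero_nat (𝕜 := ℝ)).rpow_const (p := θ)
      (Or.inr hθ.1.le)
    rw [Real.zero_rpow hθ.1.ne'] at this
    simpa using this.const_mul (2 * D)
  have hex : ∀ n : ℕ, ∃ y : Y, NX (x - y) ≤ 2 * D * (1 / ((n : ℝ) + 1)) ^ θ := by
    intro n
    have ht : 0 < 1 / ((n : ℝ) + 1) := by positivity
    have hlt : peetreK NX NY x (1 / ((n : ℝ) + 1)) < 2 * D * (1 / ((n : ℝ) + 1)) ^ θ := by
      refine (hD _ ht).trans_lt ?_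
      have : 0 < D * (1 / ((n : ℝ) + 1)) ^ θ := by positivity
      linarith
    obtain ⟨y, hy⟩ := exists_lt_of_peetreK_lt NX NY hlt
    have := mul_nonneg ht.le (NY.nonneg' y)
    exact ⟨y, by linarith⟩
  choose y hy using hex
  refine hcl (fun n => y n) x (fun n => (y n).2)
    (squeeze_zero (fun n => NX.nonneg' _) (fun n => ?_) hlim)
  rw [← NX.map_neg', neg_sub]
  exact hy n

end QuasiNorm

/-! ### Kernel estimates and a codimension criterion. -/

theorem sum_min_inv_le_three {z : ℕ → ℝ} (hz : ∀ n, 0 < z n) (h : ∀ n, 2 * z (n + 1) ≤ z n)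
    (N : ℕ) : ∑ m ∈ Finset.range N, min (z m) (z m)⁻¹ ≤ 3 := by
  -- While `z N ≥ 1` the terms grow geometrically and the sum is below the next reciprocal;
  -- afterwards `2 * z N` is the reserve for the remaining decreasing tail.
  have key : ∑ m ∈ Finset.range N, min (z m) (z m)⁻¹ ≤
      if 1 ≤ z N then (z N)⁻¹ else 3 - 2 * z N := by
    induction N with
    | zero =>
      rw [Finset.range_zero, Finset.sum_empty]
      split_ifs with h1
      · exact (inv_pos.2 (hz 0)).le
      · linarith
    | succ n ih =>
      rw [Finset.sum_range_succ]
      have h1 := hz n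
      have h2 := hz (n + 1)
      have h3 := h n
      have h4 : z n * (z n)⁻¹ = 1 := mul_inv_cancel₀ h1.ne'
      have h5 : 0 < (z n)⁻¹ := inv_pos.2 h1
      split_ifs with h6
      · rw [if_pos (by linarith)] at ih
        have h7 : 2 * (z n)⁻¹ ≤ (z (n + 1))⁻¹ := by
          rw [← div_eq_mul_inv, div_le_iff₀ h1, inv_mul_eq_div, le_div_iff₀ h2]
          exact h3
        have := min_le_right (z n) (z n)⁻¹
        linarith
      · push Not at h6
        split_ifs at ih with h8
        · have := min_le_right (z n) (z n)⁻¹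
          rcases le_total (z n) 2 with h9 | h9
          · have h10 : 2 * (z n)⁻¹ ≤ 3 - z n := by
              rw [← div_eq_mul_inv, div_le_iff₀ h1]
              nlinarith
            linarith
          · have h10 : (z n)⁻¹ ≤ 1 / 2 := by nlinarith
            linarith
        · have := min_le_left (z n) (z n)⁻¹
          linarith
  refine key.trans ?_
  have := hz N
  split_ifs with h1
  · exact (inv_le_one_of_one_le₀ h1).trans (by norm_num)
  · linarith

/-- For `θ` in `(0, 1)` this gives decay away from `s = t` on both sides: rate `θ` for `t < s` and
`1 - θ` for `t > s`. -/
theorem rpow_mul_min_le {θ : ℝ} {s t : ℝ} (hs : 0 < s) (ht : 0 < t) :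
    t ^ θ * min 1 (s / t) ≤ s ^ θ * min (t / s) (s / t) ^ min θ (1 - θ) := by
  rcases le_total t s with h | h
  · have h1 : t / s ≤ 1 := (div_le_one hs).2 h
    have h2 : 1 ≤ s / t := (one_le_div ht).2 h
    rw [min_eq_left h2, min_eq_left (h1.trans h2), mul_one]
    calc t ^ θ = s ^ θ * (t / s) ^ θ := by
          rw [← Real.mul_rpow hs.le (by positivity), mul_div_cancel₀ _ hs.ne']
      _ ≤ _ := mul_le_mul_of_nonneg_left
          (Real.rpow_le_rpow_of_exponent_ge (by positivity) h1 (min_le_left _ _)) (by positivity)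
  · have h1 : s / t ≤ 1 := (div_le_one ht).2 h
    have h2 : 1 ≤ t / s := (one_le_div hs).2 h
    rw [min_eq_right h1, min_eq_right (h1.trans h2)]
    calc t ^ θ * (s / t) = s ^ θ * (s / t) ^ (1 - θ) := by
          rw [Real.rpow_sub (by positivity), Real.rpow_one, Real.div_rpow hs.le ht.le]
          field_simp
      _ ≤ _ := mul_le_mul_of_nonneg_left
          (Real.rpow_le_rpow_of_exponent_ge (by positivity) h1 (min_le_right _ _)) (by positivity)

theorem lintegral_inv_mul_min_rpow_le {T τ : ℝ} (hT : 0 < T) (hτ : 0 < τ) :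
    ∫⁻ s in Set.Ioi (0 : ℝ), ENNReal.ofReal (s⁻¹ * min (T / s) (s / T) ^ τ) ≤
      ENNReal.ofReal (2 / τ) := by
  rw [← Set.Ioc_union_Ioi_eq_Ioi hT.le, show (2 : ℝ) / τ = 1 / τ + 1 / τ by ring,
    ENNReal.ofReal_add (by positivity) (by positivity)]
  refine (lintegral_union_le _ _ _).trans (add_le_add ?_ ?_)
  · have hint : IntegrableOn (fun s : ℝ => (T ^ τ)⁻¹ * s ^ (τ - 1)) (Set.Ioc 0 T) :=
      ((intervalIntegrable_iff_integrableOn_Ioc_of_le hT.le).1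
        (intervalIntegral.intervalIntegrable_rpow' (by linarith))).const_mul _
    calc _ ≤ ∫⁻ s in Set.Ioc 0 T, ENNReal.ofReal ((T ^ τ)⁻¹ * s ^ (τ - 1)) := by
          refine setLIntegral_mono' measurableSet_Ioc fun s hs => ENNReal.ofReal_le_ofReal ?_
          have hs0 : 0 < s := hs.1
          calc s⁻¹ * min (T / s) (s / T) ^ τ ≤ s⁻¹ * (s / T) ^ τ :=
                mul_le_mul_of_nonneg_left (Real.rpow_le_rpow (by positivity) (min_le_right _ _)
                  hτ.le) (by positivity)
            _ = _ := by
                rw [Real.div_rpow hs0.le hT.le, Real.rpow_sub_one hs0.ne']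
                field_simp
      _ = ENNReal.ofReal (∫ s in Set.Ioc 0 T, (T ^ τ)⁻¹ * s ^ (τ - 1)) := by
          rw [ofReal_integral_eq_lintegral_ofReal hint]
          filter_upwards [ae_restrict_mem measurableSet_Ioc] with s hs
          have hs0 : 0 < s := hs.1
          positivity
      _ ≤ _ := by
          refine ENNReal.ofReal_le_ofReal (le_of_eq ?_)
          rw [integral_const_mul, ← intervalIntegral.integral_of_le hT.le,
            integral_rpow (Or.inl (by linarith)), sub_add_cancel, Real.zero_rpow hτ.ne', sub_zero]
          field_simp
  · have hint : IntegrableOn (fun s : ℝ => T ^ τ * s ^ (-τ - 1)) (Set.Ioi T) :=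
      (integrableOn_Ioi_rpow_of_lt (by linarith) hT).const_mul _
    calc _ ≤ ∫⁻ s in Set.Ioi T, ENNReal.ofReal (T ^ τ * s ^ (-τ - 1)) := by
          refine setLIntegral_mono' measurableSet_Ioi fun s (hs : T < s) =>
            ENNReal.ofReal_le_ofReal ?_
          have hs0 : 0 < s := hT.trans hs
          calc s⁻¹ * min (T / s) (s / T) ^ τ ≤ s⁻¹ * (T / s) ^ τ :=
                mul_le_mul_of_nonneg_left (Real.rpow_le_rpow (by positivity) (min_le_left _ _)
                  hτ.le) (by positivity)
            _ = _ := by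
                rw [Real.div_rpow hT.le hs0.le, Real.rpow_sub_one hs0.ne', Real.rpow_neg hs0.le]
                field_simp
      _ = ENNReal.ofReal (∫ s in Set.Ioi T, T ^ τ * s ^ (-τ - 1)) := by
          rw [ofReal_integral_eq_lintegral_ofReal hint]
          filter_upwards [ae_restrict_mem measurableSet_Ioi] with s (hs : T < s)
          have hs0 : 0 < s := hT.trans hs
          positivity
      _ ≤ _ := by
          refine ENNReal.ofReal_le_ofReal (le_of_eq ?_)
          rw [integral_const_mul, integral_Ioi_rpow_of_lt (by linarith) hT, sub_add_cancel,
            Real.rpow_neg hT.le]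
          field_simp

/-- An infinite strictly descending chain of subspaces between `A` and `B` shows that `A` has
infinite codimension in `B`. -/
theorem HasInfiniteCodimIn.of_strictAnti {𝕜 E : Type*} [Field 𝕜] [AddCommGroup E] [Module 𝕜 E]
    {A B : Submodule 𝕜 E} {S : ℕ → Submodule 𝕜 E} (hS : StrictAnti S) (hA : ∀ n, A ≤ S n)
    (hB : ∀ n, S n ≤ B) : HasInfiniteCodimIn A B := by
  refine ⟨(hA 0).trans (hB 0), fun hfin => ?_⟩
  let f : ℕ →o (Submodule 𝕜 (B ⧸ A.submoduleOf B))ᵒᵈ :=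
    ⟨fun n => OrderDual.toDual (((S n).submoduleOf B).map (A.submoduleOf B).mkQ),
      fun m n hmn => Submodule.map_mono (Submodule.comap_mono (hS.antitone hmn))⟩
  obtain ⟨n, hn⟩ := IsArtinian.monotone_stabilizes f
  have h1 : ((S n).submoduleOf B).map (A.submoduleOf B).mkQ
      = ((S (n + 1)).submoduleOf B).map (A.submoduleOf B).mkQ := hn (n + 1) n.le_succ
  have h2 := congrArg (Submodule.comap (A.submoduleOf B).mkQ) h1
  -- As `A` lies in every `S n`, pulling back from the quotient loses nothing.
  rw [Submodule.comap_map_mkQ, Submodule.comap_map_mkQ,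
    sup_eq_right.2 (Submodule.comap_mono (hA n)),
    sup_eq_right.2 (Submodule.comap_mono (hA (n + 1)))] at h2
  refine (hS n.lt_succ_self).not_ge fun x hx => ?_
  have : (⟨x, hB n hx⟩ : B) ∈ (S (n + 1)).submoduleOf B := h2 ▸ hx
  exact this

/-! ### Elements with prescribed `K`-functional and strict inclusions. -/

namespace QuasiNorm

variable {𝕜 : Type*} [RCLike 𝕜] {E : Type*} [AddCommGroup E] [Module 𝕜 E]
variable {NX : QuasiNorm 𝕜 E} {Y : Submodule 𝕜 E} {NY : QuasiNorm 𝕜 Y}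

/-- If `Y` is not closed in `X`, every slowly varying positive sequence `a` is realized, up to
constants, by the values of `t ^ (-θ) * K(x, t)` along a lacunary sequence of scales `t`. -/
theorem exists_peetreK_lacunary (hX : NX.IsQuasiBanach) (hY : NY.IsQuasiBanach)
    (hYX : NX.ContinuouslyEmbedded NY) (hcl : ¬ NX.IsClosedSet (Y : Set E)) {θ : ℝ}
    (hθ : θ ∈ Set.Ioo (0 : ℝ) 1) {a : ℕ → ℝ} (ha : ∀ n, 0 < a n) {A : ℝ} (hA : 1 ≤ A)
    (ha1 : ∀ n, a (n + 1) ≤ A * a n) (ha2 : ∀ n, a n ≤ A * a (n + 1)) {R : ℝ} (hR : 0 < R) :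
    ∃ (x : E) (t : ℕ → ℝ) (ρ τ κ D : ℝ), 0 < ρ ∧ ρ ≤ R ∧ 0 < τ ∧ 0 < κ ∧ 0 < D ∧
      (∀ n, 0 < t n) ∧ (∀ n, 2 * t (n + 1) ≤ t n) ∧
      (∀ n, κ * (a n * t n ^ θ) ≤ peetreK NX NY x (t n)) ∧
      (∀ s : ℝ, 0 < s → ∀ N,
        ∑ m ∈ Finset.range N, min (t m / s) (s / t m) ^ τ ≤ 3) ∧
      ∀ s : ℝ, 0 < s → ∀ M : ℝ, 0 ≤ M →
        (∀ N, ∑ m ∈ Finset.range N, min (t m / s) (s / t m) ^ τ * a m ^ ρ ≤ M) →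
        peetreK NX NY x s ≤ D * s ^ θ * M ^ ρ⁻¹ := by
  obtain ⟨hθ0, hθ1⟩ := hθ
  obtain ⟨C, hC, hXC, hYC, hKC⟩ := exists_quasiAdd NX NY
  have hC0 : 0 < C := by linarith
  obtain ⟨ρ₀, hρ₀, hAR⟩ := QuasiAdd.exists_rpow_sum_le hC
  obtain ⟨c, hc, hgood⟩ := exists_le_peetreK_of_not_isClosedSet hY hYX hcl
  set ρ := min ρ₀ R with hρdef
  have hρ : 0 < ρ := lt_min hρ₀ hR
  have hKρ : ∀ t : ℝ, 0 ≤ t → ∀ (s : Finset ℕ) (x : ℕ → E),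
      peetreK NX NY (∑ i ∈ s, x i) t ^ ρ ≤ 2 * ∑ i ∈ s, peetreK NX NY (x i) t ^ ρ :=
    fun t ht s x => hAR ρ hρ (min_le_left _ _) (fun x => peetreK NX NY x t)
      (fun x => peetreK_nonneg NX NY x ht) (peetreK_zero NX NY ht)
      (fun x => peetreK_neg NX NY x ht) (hKC t ht) s x
  set l := min θ (1 - θ) with hl
  have hl0 : 0 < l := lt_min hθ0 (by linarith)
  -- The coefficients are `b n = a n * t n ^ θ`. If scales shrink by `δ`, then `b n` decreases and
  -- `b n / t n` increases with ratio `μ = A * δ ^ l`, which tends to `0` with `δ`.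
  obtain ⟨δ, hδ0, hδ2, hμ1, hμ2, hμ3⟩ : ∃ δ : ℝ, 0 < δ ∧ δ ≤ 1 / 2 ∧ 2 * C * (A * δ ^ l) ≤ 1 ∧
      (A * δ ^ l) ^ ρ ≤ 1 / 2 ∧ 8 * (A * δ ^ l) ^ ρ ≤ (c / (4 * C ^ 2)) ^ ρ := by
    have h0 : Tendsto (fun δ : ℝ => δ) (𝓝[>] 0) (𝓝 0) := tendsto_nhdsWithin_of_tendsto_nhds tendsto_id
    have h1 : Tendsto (fun δ : ℝ => A * δ ^ l) (𝓝[>] 0) (𝓝 0) := by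
      have := (h0.rpow_const (p := l) (Or.inr hl0.le)).const_mul A
      rwa [Real.zero_rpow hl0.ne', mul_zero] at this
    have h2 : Tendsto (fun δ : ℝ => (A * δ ^ l) ^ ρ) (𝓝[>] 0) (𝓝 0) := by
      have := h1.rpow_const (p := ρ) (Or.inr hρ.le)
      rwa [Real.zero_rpow hρ.ne'] at this
    have h3 : Tendsto (fun δ : ℝ => 2 * C * (A * δ ^ l)) (𝓝[>] 0) (𝓝 0) := by
      simpa using h1.const_mul (2 * C)
    have h4 : Tendsto (fun δ : ℝ => 8 * (A * δ ^ l) ^ ρ) (𝓝[>] 0) (𝓝 0) := by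
      simpa using h2.const_mul 8
    obtain ⟨δ, h⟩ := ((((eventually_mem_nhdsWithin (a := (0 : ℝ)) (s := Set.Ioi 0)).and
      (h0.eventually (ge_mem_nhds (show (0 : ℝ) < 1 / 2 by norm_num)))).and
      (h3.eventually (ge_mem_nhds one_pos))).and
      ((h2.eventually (ge_mem_nhds (show (0 : ℝ) < 1 / 2 by norm_num))).and
      (h4.eventually (ge_mem_nhds (show (0 : ℝ) < (c / (4 * C ^ 2)) ^ ρ by positivity))))).exists
    exact ⟨δ, h.1.1.1, h.1.1.2, h.1.2, h.2.1, h.2.2⟩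
  choose! F hF0 hF1 hF2 using hgood
  -- Each new scale is a good scale below `δ` times the previous one.
  obtain ⟨t, ht0, hts⟩ : ∃ t : ℕ → ℝ, t 0 = F 1 ∧ ∀ n, t (n + 1) = F (δ * t n) :=
    ⟨fun n => Nat.rec (F 1) (fun _ s => F (δ * s)) n, rfl, fun _ => rfl⟩
  have ht : ∀ n, 0 < t n := by
    intro n
    induction n with
    | zero => rw [ht0]; exact hF0 1 one_pos
    | succ n ih => rw [hts]; exact hF0 _ (by positivity)
  have htδ : ∀ n, t (n + 1) ≤ δ * t n := fun n => by
    rw [hts]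
    exact (hF1 _ (mul_pos hδ0 (ht n))).le
  have hu : ∀ n, ∃ u : Y, NX (u : E) ≤ 1 ∧ t n * NY u ≤ 1 ∧ c ≤ peetreK NX NY (u : E) (t n) := by
    intro n
    cases n with
    | zero => rw [ht0]; exact hF2 1 one_pos
    | succ n => rw [hts]; exact hF2 _ (mul_pos hδ0 (ht n))
  choose u hu1 hu2 hu3 using hu
  have hδ1 : δ ≤ 1 := by linarith
  have hb : ∀ n, 0 < a n * t n ^ θ := fun n => mul_pos (ha n) (Real.rpow_pos_of_pos (ht n) _)
  obtain ⟨x, hx1, hx2⟩ := exists_lacunary_sum (NY := NY) hX hC hXC hKC hρ hKρ hc ht hb hu1 hu2 hu3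
    (μ := A * δ ^ l) (by positivity) hμ1 hμ2 hμ3
    (fun n => by
      have h1 : t (n + 1) ^ θ ≤ δ ^ l * t n ^ θ := by
        refine (Real.rpow_le_rpow (ht _).le (htδ n) hθ0.le).trans ?_
        rw [Real.mul_rpow hδ0.le (ht n).le]
        exact mul_le_mul_of_nonneg_right
          (Real.rpow_le_rpow_of_exponent_ge hδ0 hδ1 (min_le_left _ _))
          (Real.rpow_nonneg (ht n).le _)
      refine (mul_le_mul (ha1 n) h1 (Real.rpow_nonneg (ht _).le _)
        (mul_nonneg (by linarith) (ha n).le)).trans_eq ?_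
      ring)
    (fun n => by
      have e : ∀ m, a m * t m ^ θ / t m = a m * (t m ^ (1 - θ))⁻¹ := fun m => by
        have := ht m
        rw [Real.rpow_sub this, Real.rpow_one]
        field_simp
      have h1 : (t n ^ (1 - θ))⁻¹ ≤ δ ^ l * (t (n + 1) ^ (1 - θ))⁻¹ := by
        have hp := Real.rpow_pos_of_pos (ht n) (1 - θ)
        have hp' := Real.rpow_pos_of_pos (ht (n + 1)) (1 - θ)
        rw [← div_eq_mul_inv, inv_eq_one_div, div_le_div_iff₀ hp hp', one_mul]
        refine (Real.rpow_le_rpow (ht _).le (htδ n) (by linarith)).trans ?_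
        rw [Real.mul_rpow hδ0.le (ht n).le]
        exact mul_le_mul_of_nonneg_right
          (Real.rpow_le_rpow_of_exponent_ge hδ0 hδ1 (min_le_right _ _)) hp.le
      rw [e, e]
      refine (mul_le_mul (ha2 n) h1 (inv_nonneg.2 (Real.rpow_nonneg (ht _).le _))
        (mul_nonneg (by linarith) (ha _).le)).trans_eq ?_
      ring)
  refine ⟨x, t, ρ, l * ρ, c / (2 * C), C * 2 ^ ρ⁻¹, hρ, min_le_right _ _, by positivity,
    by positivity, by positivity, ht, fun n => ?_, hx1, fun s hs N => ?_, fun s hs M hM0 hM => ?_⟩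
  · have := htδ n
    have := ht n
    nlinarith
  · have hz : ∀ m, 0 < (t m / s) ^ (l * ρ) := fun m => Real.rpow_pos_of_pos (div_pos (ht m) hs) _
    refine le_trans (Finset.sum_le_sum fun m _ => ?_) (sum_min_inv_le_three hz (fun m => ?_) N)
    · have htm := ht m
      have hmin : 0 ≤ min (t m / s) (s / t m) := le_min (by positivity) (by positivity)
      refine le_min (Real.rpow_le_rpow hmin (min_le_left _ _) (by positivity)) ?_
      rw [← Real.inv_rpow (by positivity), inv_div]
      exact Real.rpow_le_rpow hmin (min_le_right _ _) (by positivity)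
    · have htm := ht m
      have htm' := ht (m + 1)
      have h1 : t (m + 1) / s ≤ δ * (t m / s) := by
        rw [← mul_div_assoc]
        exact div_le_div_of_nonneg_right (htδ m) hs.le
      have h2 : δ ^ (l * ρ) ≤ 1 / 2 := by
        rw [Real.rpow_mul hδ0.le]
        refine (Real.rpow_le_rpow (by positivity) ?_ hρ.le).trans hμ2
        exact le_mul_of_one_le_left (by positivity) hA
      have h3 := Real.rpow_le_rpow (by positivity) h1 (show 0 ≤ l * ρ by positivity)
      rw [Real.mul_rpow hδ0.le (by positivity)] at h3
      have := hz m
      nlinarith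
  · have h1 : ∀ N, ∑ m ∈ Finset.range N, (a m * t m ^ θ * min 1 (s / t m)) ^ ρ
        ≤ s ^ (θ * ρ) * M := by
      intro N
      refine le_trans ?_ (mul_le_mul_of_nonneg_left (hM N) (by positivity))
      rw [Finset.mul_sum]
      refine Finset.sum_le_sum fun m _ => ?_
      have htm := ht m
      have ham := ha m
      have hmin : 0 < min (t m / s) (s / t m) := lt_min (by positivity) (by positivity)
      calc (a m * t m ^ θ * min 1 (s / t m)) ^ ρ
          ≤ (a m * (s ^ θ * min (t m / s) (s / t m) ^ l)) ^ ρ := by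
            refine Real.rpow_le_rpow ?_ ?_ hρ.le
            · have : 0 < min 1 (s / t m) := lt_min one_pos (by positivity)
              positivity
            · rw [mul_assoc]
              exact mul_le_mul_of_nonneg_left (rpow_mul_min_le hs htm) ham.le
        _ = _ := by
            rw [Real.mul_rpow ham.le (by positivity), Real.mul_rpow (by positivity) (by positivity),
              ← Real.rpow_mul hs.le, ← Real.rpow_mul hmin.le]
            ring
    refine (hx2 s hs _ (by positivity) h1).trans_eq ?_
    rw [Real.mul_rpow zero_le_two (by positivity), Real.mul_rpow (by positivity) hM0,
      ← Real.rpow_mul hs.le, mul_assoc θ, mul_inv_cancel₀ hρ.ne', mul_one]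
    ring

/-- With constant profile at an intermediate exponent `σ`, the element has `K(x, s) ≲ s ^ σ`
everywhere and `K(x, t) ≳ t ^ σ` along scales tending to `0`. The first puts it in the `θ₀`-space,
the second keeps it out of the `θ₁`-space. -/
theorem interp_lt_interp_of_lt (hX : NX.IsQuasiBanach) (hY : NY.IsQuasiBanach)
    (hYX : NX.ContinuouslyEmbedded NY) (hcl : ¬ NX.IsClosedSet (Y : Set E)) {θ₀ θ₁ : ℝ}
    (h0 : 0 < θ₀) (h01 : θ₀ < θ₁) (h1 : θ₁ < 1) {p q : ℝ≥0∞} (hp : 0 < p) (hq : 0 < q) :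
    NX.interp NY θ₁ q < NX.interp NY θ₀ p := by
  refine lt_of_le_of_ne (interp_le_interp h0 h01 hq hp) fun heq => ?_
  set σ := (θ₀ + θ₁) / 2 with hσ
  obtain ⟨x, t, ρ, τ, κ, D, hρ, -, hτ, hκ, hD, ht, ht2, hlow, hsum, hup⟩ :=
    exists_peetreK_lacunary hX hY hYX hcl (θ := σ) ⟨by linarith, by linarith⟩ (a := fun _ => 1)
      (fun _ => one_pos) le_rfl (fun _ => by simp) (fun _ => by simp) (R := 1) one_pos
  have hmem : x ∈ NX.interp NY θ₀ p := by
    refine mem_interp_of_peetreK_le h0 (σ := σ) (by linarith) hp (D := D * 3 ^ ρ⁻¹) fun s hs _ => ?_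
    refine (hup s hs 3 (by norm_num) fun N => ?_).trans_eq (by ring)
    simpa using hsum s hs N
  rw [← heq] at hmem
  obtain ⟨D', hD', hle⟩ := exists_peetreK_le_of_mem_interp (h0.trans h01).le hq hmem
  have htlim : Tendsto t atTop (𝓝 0) := by
    have hgeo : ∀ n, t n ≤ t 0 * (1 / 2) ^ n := by
      intro n
      induction n with
      | zero => simp
      | succ n ih => rw [pow_succ]; linarith [ht2 n]
    refine squeeze_zero (fun n => (ht n).le) hgeo ?_
    simpa using (tendsto_pow_atTop_nhds_zero_of_lt_one (r := (1 / 2 : ℝ)) (by norm_num)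
      (by norm_num)).const_mul (t 0)
  have hlim : Tendsto (fun n => D' * t n ^ (θ₁ - σ)) atTop (𝓝 0) := by
    have hpos : 0 < θ₁ - σ := by linarith
    have := (htlim.rpow_const (p := θ₁ - σ) (Or.inr hpos.le)).const_mul D'
    rwa [Real.zero_rpow hpos.ne', mul_zero] at this
  refine hκ.not_ge (ge_of_tendsto' hlim fun n => ?_)
  have htn := ht n
  have h2 := (hlow n).trans (hle (t n) htn)
  rw [one_mul] at h2
  rw [Real.rpow_sub htn, ← mul_div_assoc, le_div_iff₀ (by positivity)]
  exact h2

/-- The profile `a n = (n + 1) ^ (-1/p)` is in `ℓ^q` for `q > p` (bounded if `q = ∞`) but not in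
`ℓ^p`, where it gives the harmonic series. -/
theorem exists_mem_interp_notMem_interp (hX : NX.IsQuasiBanach) (hY : NY.IsQuasiBanach)
    (hYX : NX.ContinuouslyEmbedded NY) (hcl : ¬ NX.IsClosedSet (Y : Set E)) {θ : ℝ}
    (hθ : θ ∈ Set.Ioo (0 : ℝ) 1) {p q : ℝ≥0∞} (hp : 0 < p) (hpq : p < q) :
    ∃ x ∈ NX.interp NY θ q, x ∉ NX.interp NY θ p := by
  have hpt : p ≠ ∞ := hpq.ne_top
  set r := p.toReal with hr
  have hr0 : 0 < r := ENNReal.toReal_pos hp.ne' hpt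
  have ha : ∀ n : ℕ, 0 < ((n : ℝ) + 1) ^ (-r⁻¹) := fun n => by positivity
  -- For finite `q` the cap forces `ρ ≤ q`, which the convexity argument with exponent `q / ρ`
  -- needs; for `q = ∞` any cap would do.
  have hR : 0 < if q = ∞ then 1 else q.toReal := by
    split_ifs with h
    · exact one_pos
    · exact ENNReal.toReal_pos (hp.trans hpq).ne' h
  obtain ⟨x, t, ρ, τ, κ, D, hρ, hρR, hτ, hκ, hD, ht, ht2, hlow, hsum, hup⟩ :=
    exists_peetreK_lacunary hX hY hYX hcl hθ (a := fun n : ℕ => ((n : ℝ) + 1) ^ (-r⁻¹)) ha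
      (A := 2 ^ r⁻¹) (Real.one_le_rpow one_le_two (by positivity))
      (fun n => by
        refine (Real.rpow_le_rpow_of_nonpos (by positivity) (y := ((n + 1 : ℕ) : ℝ) + 1)
          (x := (n : ℝ) + 1) (by push_cast; linarith) (by simpa using hr0.le)).trans ?_
        exact le_mul_of_one_le_left (ha n).le (Real.one_le_rpow one_le_two (by positivity)))
      (fun n => by
        rw [Real.rpow_neg (by positivity), Real.rpow_neg (by positivity), ← div_eq_mul_inv,
          ← Real.div_rpow (by positivity) (by positivity), ← Real.inv_rpow (by positivity)]
        refine Real.rpow_le_rpow (by positivity) ?_ (by positivity)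
        rw [inv_eq_one_div, div_le_div_iff₀ (by positivity) (by positivity)]
        push_cast
        nlinarith [(Nat.cast_nonneg n : (0 : ℝ) ≤ n)]) hR
  have hk0 : ∀ m s, 0 < s → 0 < min (t m / s) (s / t m) ^ τ := fun m s hs =>
    Real.rpow_pos_of_pos (lt_min (div_pos (ht m) hs) (div_pos hs (ht m))) _
  have ha1 : ∀ n : ℕ, ((n : ℝ) + 1) ^ (-r⁻¹) ≤ 1 := fun n =>
    Real.rpow_le_one_of_one_le_of_nonpos (by linarith [(Nat.cast_nonneg n : (0 : ℝ) ≤ n)])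
      (by simpa using hr0.le)
  refine ⟨x, ?_, fun hxp => ?_⟩
  · rcases eq_or_ne q ∞ with rfl | hqt
    · refine mem_interp_top (D := D * 3 ^ ρ⁻¹) fun s hs => ?_
      refine (hup s hs 3 (by norm_num) fun N => ?_).trans_eq (by ring)
      refine (Finset.sum_le_sum fun m _ => ?_).trans (hsum s hs N)
      exact mul_le_of_le_one_right (hk0 m s hs).le (Real.rpow_le_one (ha m).le (ha1 m) hρ.le)
    · rw [if_neg hqt] at hρR
      set v := q.toReal with hv
      have hv0 : 0 < v := ENNReal.toReal_pos (hp.trans hpq).ne' hqt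
      have hrv : r < v := (ENNReal.toReal_lt_toReal hpt hqt).2 hpq
      have hρv : 1 ≤ v / ρ := (one_le_div hρ).2 hρR
      have hav : ∀ n : ℕ, (((n : ℝ) + 1) ^ (-r⁻¹)) ^ v ≤ 1 := fun n =>
        Real.rpow_le_one (ha n).le (ha1 n) hv0.le
      set G : ℝ → ℕ → ℝ := fun s m =>
        min (t m / s) (s / t m) ^ τ * (((m : ℝ) + 1) ^ (-r⁻¹)) ^ v with hG
      have hG0 : ∀ s, 0 < s → ∀ m, 0 ≤ G s m := fun s hs m =>
        mul_nonneg (hk0 m s hs).le (Real.rpow_nonneg (ha m).le _)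
      have hGs : ∀ s, 0 < s → Summable (G s) := fun s hs =>
        summable_of_sum_range_le (c := 3) (hG0 s hs) fun N =>
          (Finset.sum_le_sum fun m _ => mul_le_of_le_one_right (hk0 m s hs).le (hav m)).trans
            (hsum s hs N)
      have hK : ∀ s, 0 < s → peetreK NX NY x s ^ v
          ≤ D ^ v * 3 ^ (v / ρ - 1) * s ^ (θ * v) * ∑' m, G s m := by
        intro s hs
        have hT0 : 0 ≤ ∑' m, G s m := tsum_nonneg (hG0 s hs)
        -- Weighted Hölder with exponent `v / ρ`: the kernel weights have total mass at most `3`, so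
        -- the sum with `a ^ ρ` is controlled by the sum with `a ^ v`.
        have h1 := hup s hs (3 ^ (1 - (v / ρ)⁻¹) * (∑' m, G s m) ^ (v / ρ)⁻¹) (by positivity)
          fun N => by
            refine (Finset.sum_le_sum fun m _ => ?_ : _ ≤ ∑ m ∈ Finset.range N,
              max 0 (min (t m / s) (s / t m) ^ τ) * (((m : ℝ) + 1) ^ (-r⁻¹)) ^ ρ).trans
              ((Real.inner_le_weight_mul_Lp_of_nonneg (Finset.range N) hρv _ _
                (fun m => le_max_left _ _) (fun m => Real.rpow_nonneg (ha m).le _)).trans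
                (mul_le_mul ?_ ?_ ?_ ?_))
            · exact mul_le_mul_of_nonneg_right (le_max_right _ _) (Real.rpow_nonneg (ha m).le _)
            · refine Real.rpow_le_rpow (Finset.sum_nonneg fun m _ => le_max_left _ _) ?_
                (sub_nonneg.2 (inv_le_one_of_one_le₀ hρv))
              simp only [fun m => max_eq_right (hk0 m s hs).le]
              exact hsum s hs N
            · refine Real.rpow_le_rpow (Finset.sum_nonneg fun m _ => mul_nonneg (le_max_left _ _)
                (Real.rpow_nonneg (Real.rpow_nonneg (ha m).le _) _)) ?_ (by positivity)
              simp only [fun m => max_eq_right (hk0 m s hs).le]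
              simp only [fun m : ℕ => show ((((m : ℝ) + 1) ^ (-r⁻¹)) ^ ρ) ^ (v / ρ)
                = (((m : ℝ) + 1) ^ (-r⁻¹)) ^ v by
                  rw [← Real.rpow_mul (ha m).le, mul_div_cancel₀ _ hρ.ne']]
              exact (hGs s hs).sum_le_tsum _ fun m _ => hG0 s hs m
            · exact Real.rpow_nonneg (Finset.sum_nonneg fun m _ => mul_nonneg (le_max_left _ _)
                (Real.rpow_nonneg (Real.rpow_nonneg (ha m).le _) _)) _
            · positivity
        refine (Real.rpow_le_rpow (peetreK_nonneg NX NY x hs.le) h1 hv0.le).trans_eq ?_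
        rw [Real.mul_rpow (by positivity) (by positivity), Real.mul_rpow hD.le (by positivity),
          ← Real.rpow_mul (by positivity) ρ⁻¹, inv_mul_eq_div ρ v,
          Real.mul_rpow (by positivity) (by positivity), ← Real.rpow_mul (by positivity),
          ← Real.rpow_mul hT0, inv_mul_cancel₀ (by positivity), Real.rpow_one,
          ← Real.rpow_mul (by norm_num), sub_mul, inv_mul_cancel₀ (by positivity), one_mul]
        ring
      rw [mem_interp_iff_lintegral (hp.trans hpq).ne' hqt]
      set B : ℝ := D ^ v * 3 ^ (v / ρ - 1) with hB
      have hB0 : 0 < B := by positivity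
      have hpt : ∀ s ∈ Set.Ioi (0 : ℝ),
          ENNReal.ofReal (s ^ (-(θ * v + 1)) * peetreK NX NY x s ^ v) ≤
            ∑' m : ℕ, ENNReal.ofReal (B * (((m : ℝ) + 1) ^ (-r⁻¹)) ^ v) *
              ENNReal.ofReal (s⁻¹ * min (t m / s) (s / t m) ^ τ) := by
        intro s (hs : 0 < s)
        have h1 : s ^ (-(θ * v + 1)) * peetreK NX NY x s ^ v ≤ B * s⁻¹ * ∑' m, G s m := by
          refine (mul_le_mul_of_nonneg_left (hK s hs) (by positivity)).trans_eq ?_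
          rw [neg_add, Real.rpow_add hs, Real.rpow_neg hs.le, Real.rpow_neg_one]
          have : 0 < s ^ (θ * v) := by positivity
          field_simp
        refine (ENNReal.ofReal_le_ofReal h1).trans_eq ?_
        rw [← tsum_mul_left, ENNReal.ofReal_tsum_of_nonneg
          (fun m => mul_nonneg (by positivity) (hG0 s hs m)) ((hGs s hs).mul_left _)]
        refine tsum_congr fun m => ?_
        rw [← ENNReal.ofReal_mul (mul_nonneg hB0.le (Real.rpow_nonneg (ha m).le _))]
        congr 1
        rw [hG]
        ring
      -- Summing after integration: each kernel has mass at most `2 / τ` for `ds / s`, whatever its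
      -- scale, leaving the series of `a m ^ v`.
      refine (setLIntegral_mono' measurableSet_Ioi hpt).trans_lt ?_
      rw [lintegral_tsum fun m => by fun_prop]
      have hterm : ∀ m : ℕ, ∫⁻ s in Set.Ioi (0 : ℝ),
          ENNReal.ofReal (B * (((m : ℝ) + 1) ^ (-r⁻¹)) ^ v) *
              ENNReal.ofReal (s⁻¹ * min (t m / s) (s / t m) ^ τ) ≤
          ENNReal.ofReal (B * (2 / τ) * ((m : ℝ) + 1) ^ (-(v / r))) := by
        intro m
        rw [lintegral_const_mul _ (by fun_prop)]
        refine (mul_le_mul_right (lintegral_inv_mul_min_rpow_le (ht m) hτ) _).trans_eq ?_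
        rw [← ENNReal.ofReal_mul (mul_nonneg hB0.le (Real.rpow_nonneg (ha m).le _)),
          ← Real.rpow_mul (by positivity)]
        congr 1
        rw [show -r⁻¹ * v = -(v / r) by ring]
        ring
      refine (ENNReal.tsum_le_tsum hterm).trans_lt ?_
      have hsm : Summable fun m : ℕ => B * (2 / τ) * ((m : ℝ) + 1) ^ (-(v / r)) := by
        refine Summable.mul_left _ ?_
        have h1 : Summable fun m : ℕ => (m : ℝ) ^ (-(v / r)) :=
          Real.summable_nat_rpow.2 (neg_lt_neg ((one_lt_div hr0).2 hrv))
        have h2 := (summable_nat_add_iff 1).2 h1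
        simpa using h2
      exact hsm.tsum_ofReal_lt_top
  · have h1 := summable_of_mem_interp hθ.1.le hp.ne' hpt hxp ht ht2
    have h2 : Summable fun n : ℕ => κ ^ r * (((n + 1 : ℕ) : ℝ))⁻¹ := by
      refine Summable.of_nonneg_of_le (fun n => by positivity) (fun n => ?_) h1
      have htn := ht n
      calc κ ^ r * (((n + 1 : ℕ) : ℝ))⁻¹
          = t n ^ (-(θ * r)) * (κ * (((n : ℝ) + 1) ^ (-r⁻¹) * t n ^ θ)) ^ r := by
            rw [Real.mul_rpow hκ.le (by positivity), Real.mul_rpow (ha n).le (by positivity),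
              ← Real.rpow_mul (by positivity), ← Real.rpow_mul htn.le, Real.rpow_neg htn.le,
              neg_mul, inv_mul_cancel₀ hr0.ne', Real.rpow_neg_one]
            push_cast
            field_simp
        _ ≤ _ := mul_le_mul_of_nonneg_left
            (Real.rpow_le_rpow (by positivity) (hlow n) hr0.le) (by positivity)
    rw [summable_mul_left_iff (by positivity)] at h2
    exact Real.not_summable_natCast_inv ((summable_nat_add_iff 1).1 h2)

theorem strictAnti_interp (hX : NX.IsQuasiBanach) (hY : NY.IsQuasiBanach)
    (hYX : NX.ContinuouslyEmbedded NY) (hcl : ¬ NX.IsClosedSet (Y : Set E)) {p : ℝ≥0∞}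
    (hp : 0 < p) {θ : ℕ → ℝ} (hθ : StrictMono θ) (h : ∀ n, θ n ∈ Set.Ioo (0 : ℝ) 1) :
    StrictAnti fun n => NX.interp NY (θ n) p := fun m n hmn =>
  interp_lt_interp_of_lt hX hY hYX hcl (h m).1 (hθ hmn) (h n).2 hp hp

end QuasiNorm

/-! ### The three parts of the theorem. -/

theorem theorem5 {𝕜 : Type*} [RCLike 𝕜] {X : Type*} [AddCommGroup X] [Module 𝕜 X]
    (NX : QuasiNorm 𝕜 X) (Y : Submodule 𝕜 X) (NY : QuasiNorm 𝕜 Y)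
    (hX : NX.IsQuasiBanach) (hY : NY.IsQuasiBanach)
    (hYX : NX.ContinuouslyEmbedded NY) (hne : Y ≠ ⊤) :
    -- (a)
    (¬ NX.IsClosedSet (Y : Set X) →
      ∀ (θ₀ θ₁ : ℝ) (p q : ℝ≥0∞), θ₀ ∈ Set.Ioo (0 : ℝ) 1 → θ₁ ∈ Set.Ioo (0 : ℝ) 1 → θ₀ ≠ θ₁ →
        0 < p → 0 < q → NX.interp NY θ₀ p ≠ NX.interp NY θ₁ q) ∧
    -- (b)
    (∀ (θ : ℝ) (p q : ℝ≥0∞), θ ∈ Set.Ioo (0 : ℝ) 1 → 0 < p → 0 < q →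
      NX.interp NY θ p ≠ NX.interp NY θ q →
      ∀ r₁ r₂ : ℝ≥0∞, r₁ ∈ Set.uIcc p q → r₂ ∈ Set.uIcc p q → r₁ ≠ r₂ →
        NX.interp NY θ r₁ ≠ NX.interp NY θ r₂) ∧
    -- (c)
    (¬ NX.IsClosedSet (Y : Set X) →
      ∀ (θ : ℝ) (p : ℝ≥0∞), θ ∈ Set.Ioo (0 : ℝ) 1 → 0 < p →
        HasInfiniteCodimIn (NX.interp NY θ p) ⊤ ∧ HasInfiniteCodimIn Y (NX.interp NY θ p)) := by
  refine ⟨fun hcl θ₀ θ₁ p q h0 h1 hne hp hq => ?_, fun θ p q hθ hp hq hpq r₁ r₂ hr₁ hr₂ hr => ?_,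
    fun hcl θ p hθ hp => ⟨?_, ?_⟩⟩
  · rcases lt_or_gt_of_ne hne with h | h
    · exact (QuasiNorm.interp_lt_interp_of_lt hX hY hYX hcl h0.1 h h1.2 hp hq).ne'
    · exact (QuasiNorm.interp_lt_interp_of_lt hX hY hYX hcl h1.1 h h0.2 hq hp).ne
  · have hcl : ¬ NX.IsClosedSet (Y : Set X) := fun hcl => hpq <| by
      rw [QuasiNorm.interp_eq_of_isClosedSet hcl hθ hp, QuasiNorm.interp_eq_of_isClosedSet hcl hθ hq]
    have hmin : 0 < p ⊓ q := lt_min hp hq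
    intro heq
    rcases lt_or_gt_of_ne hr with h | h
    · obtain ⟨x, hx, hx'⟩ := QuasiNorm.exists_mem_interp_notMem_interp hX hY hYX hcl hθ
        (hmin.trans_le hr₁.1) h
      exact hx' (heq ▸ hx)
    · obtain ⟨x, hx, hx'⟩ := QuasiNorm.exists_mem_interp_notMem_interp hX hY hYX hcl hθ
        (hmin.trans_le hr₂.1) h
      exact hx' (heq ▸ hx)
  -- Exponents increasing inside `(0, θ)` give a descending chain above the `θ`-space; below,
  -- exponents inside `(θ, 1)` give one between `Y` and the `θ`-space.
  · obtain ⟨s, hs, hs1, -⟩ := exists_seq_strictMono_tendsto' hθ.1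
    exact .of_strictAnti (QuasiNorm.strictAnti_interp hX hY hYX hcl hp hs
        fun n => ⟨(hs1 n).1, (hs1 n).2.trans hθ.2⟩)
      (fun n => QuasiNorm.interp_le_interp (hs1 n).1 (hs1 n).2 hp hp) fun n => le_top
  · obtain ⟨s, hs, hs1, -⟩ := exists_seq_strictMono_tendsto' hθ.2
    exact .of_strictAnti (QuasiNorm.strictAnti_interp hX hY hYX hcl hp hs
        fun n => ⟨hθ.1.trans (hs1 n).1, (hs1 n).2⟩)
      (fun n => QuasiNorm.le_interp ⟨hθ.1.trans (hs1 n).1, (hs1 n).2⟩ hp)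
      fun n => QuasiNorm.interp_le_interp hθ.1 (hs1 n).1 hp hp
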